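/- Consider a panel of $N$ units, $T=T_0+T_1$ time periods ($T_0,T_1\ge 1$) and $D\ge 1$ interventions, where intervention $0$ is control. Potential outcomes follow the latent factor model $Y^{(d)}_{tn}=\langle u^{(d)}_t,v_n\rangle+\varepsilon_{tn}$ with random latent factors $u^{(d)}_t,v_n\in\mathbb{R}^r$. Unit $n$ receives the random intervention $D(n)$ after time $T_0$, and the observations are $Y_{tn}=Y^{(0)}_{tn}$ for $t\le T_0$ and $Y_{tn}=Y^{(D(n))}_{tn}$ for $t>T_0$. Let $\mathcal{E}$ be the collection of all latent factors and all assignments $D(n)$. Suppose that, conditionally on $\mathcal{E}$, the shocks $\varepsilon_{tn}$ are independent with $\mathbb{E}[\varepsilon_{tn}]=0$, $\mathbb{E}[\varepsilon_{tn}^2]=\sigma^2$ and $\|\varepsilon_{tn}\|_{\psi_2}\le K\sigma$, where $\sigma\ge 0$ and $K>0$ are constants. Fix an intervention $d$, and let $\mathcal{I}=\{n:D(n)=d\}$ and $N_d=|\mathcal{I}|$. Let $Y_{\rm pre}=[Y_{tj}]_{t\le T_0,\,j\in\mathcal{I}}$ and $Y_{\rm post}=[Y_{tj}]_{t>T_0,\,j\in\mathcal{I}}$,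 let $M_{\rm pre}=\mathbb{E}[Y_{\rm pre}\mid\mathcal{E}]$ and $M_{\rm post}=\mathbb{E}[Y_{\rm post}\mid\mathcal{E}]$, and let $r_{\rm pre}$, $r_{\rm post}$ be the ranks of $M_{\rm pre}$, $M_{\rm post}$. Let $V_{\rm pre}$ and $V_{\rm post}$ have as columns orthonormal right singular vectors of $M_{\rm pre}$ and $M_{\rm post}$ for their $r_{\rm pre}$ and $r_{\rm post}$ nonzero singular values, and let $\widehat V_{\rm pre}$ and $\widehat V_{\rm post}$ have as columns orthonormal right singular vectors of $Y_{\rm pre}$ and $Y_{\rm post}$ for their $r_{\rm pre}$ and $r_{\rm post}$ largest singular values (chosen arbitrarily when they are not unique). Let $s_{r_{\rm pre}}$ and $\varsigma_{r_{\rm post}}$ be the smallest nonzero singular values of $M_{\rm pre}$ and $M_{\rm post}$; when such a rank is $0$, terms divided by the corresponding singular value are read as $0$. Consider the hypotheses $$H_0:\ \mathrm{span}(V_{\rm post})\subseteq\mathrm{span}(V_{\rm pre}),\qquad H_1:\ \mathrm{span}(V_{\rm post})\not\subseteq\mathrm{span}(V_{\rm pre}),$$ the statistic $\widehat\tau=\|(I-\widehat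 V_{\rm pre}\widehat V_{\rm pre}')\widehat V_{\rm post}\|_F^2$, and, for a constant $C$, the critical value $$\tau(\alpha)=\frac{C\sigma^2 r_{\rm post}\,\phi_{\rm pre}^2(\alpha/2)}{s_{r_{\rm pre}}^2}+\frac{C\sigma^2 r_{\rm post}\,\phi_{\rm post}^2(\alpha/2)}{\varsigma_{r_{\rm post}}^2}+\frac{C\sigma r_{\rm post}\,\phi_{\rm pre}(\alpha/2)}{s_{r_{\rm pre}}},$$ where $\phi_{\rm pre}(a)=\sqrt{T_0}+\sqrt{N_d}+\sqrt{\log(1/a)}$ and $\phi_{\rm post}(a)=\sqrt{T_1}+\sqrt{N_d}+\sqrt{\log(1/a)}$. Then there is a constant $C_0\ge 0$ that depends only on $K$ such that, for every $C\ge C_0$ and every $\alpha\in(0,1)$, the following hold almost surely. (i) Type I error: if $H_0$ holds, then $\mathbb{P}(\widehat\tau>\tau(\alpha)\mid\mathcal{E})\le\alpha$. (ii) Type II error: if $$r_{\rm post}>\|V_{\rm pre}V_{\rm pre}'V_{\rm post}\|_F^2+2\tau(\alpha)+\frac{C\sigma r_{\rm post}\,\phi_{\rm post}(\alpha/2)}{\varsigma_{r_{\rm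 post}}},$$ then $H_1$ holds and $\mathbb{P}(\widehat\tau\le\tau(\alpha)\mid\mathcal{E})\le\alpha$. -/

import Mathlib

open MeasureTheory ProbabilityTheory Matrix

noncomputable section

/-- The `ℓ`-th singular value of `A` (`ℓ = 1, 2, …`), in decreasing order with multiplicity.
Mathlib's sequence starts at `0`. -/
def singularValue {m n : Type*} [Fintype m] [Fintype n] [DecidableEq n]
    (A : Matrix m n ℝ) (l : ℕ) : ℝ :=
  (Matrix.toEuclideanLin A).singularValues (l - 1)

/-- The columns of `V` are right singular vectors of `A` for its `k` largest singular values: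
they are orthonormal, and the `i`-th one satisfies `Aᵀ A v_i = s_i² v_i` with `s_i` the `i`-th
largest singular value. When singular values coincide, `V` is not unique. -/
structure IsTopRightSingularVectors {m n : Type*} [Fintype m] [Fintype n] [DecidableEq n]
    {k : ℕ} (A : Matrix m n ℝ) (V : Matrix n (Fin k) ℝ) : Prop where
  orthonormal : Vᵀ * V = 1
  eigen : ∀ i : Fin k, (Aᵀ * A) *ᵥ V.col i = (singularValue A (i + 1)) ^ 2 • V.col i

/-- The span of the columns of a matrix. -/
def colSpan {n k : Type*} (V : Matrix n k ℝ) : Submodule ℝ (n → ℝ) :=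
  Submodule.span ℝ (Set.range fun j => V.col j)

/-- The squared Frobenius norm. -/
def frobSq {m n : Type*} [Fintype m] [Fintype n] (A : Matrix m n ℝ) : ℝ :=
  ∑ i, ∑ j, A i j ^ 2

/-- The statistic `‖(I - V V') W‖_F²`. -/
def subspaceStat {n : Type*} [Fintype n] [DecidableEq n] {k l : ℕ}
    (V : Matrix n (Fin k) ℝ) (W : Matrix n (Fin l) ℝ) : ℝ :=
  frobSq ((1 - V * Vᵀ) * W)

/-- The sub-Gaussian (Orlicz) norm `inf {t > 0 : 𝔼 exp (X² / t²) ≤ 2}`, which is `∞` if there is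
no such `t`. -/
def psiTwoNorm {Ω : Type*} [MeasurableSpace Ω] (X : Ω → ℝ) (μ : Measure Ω) : ENNReal :=
  ⨅ (t : ℝ) (_ : 0 < t)
    (_ : ∫⁻ ω, ENNReal.ofReal (Real.exp (X ω ^ 2 / t ^ 2)) ∂μ ≤ 2), ENNReal.ofReal t

/-- `φ(a) = √T + √n + √(log (1 / a))`. -/
def phi (T n : ℕ) (a : ℝ) : ℝ :=
  Real.sqrt T + Real.sqrt n + Real.sqrt (Real.log (1 / a))

/-- The random objects of the panel: `N` units, `T₀` pre- and `T₁` post-intervention periods (the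
times `t < T₀` and `T₀ ≤ t` of `Fin (T₀ + T₁)`), `D` interventions and `r`-dimensional latent
factors. -/
structure Panel (Ω : Type*) [MeasurableSpace Ω] (N T₀ T₁ D r : ℕ) where
  /-- intervention received by a unit in the post-intervention period -/
  assign : Fin N → Ω → Fin D
  /-- time-intervention factor `u_t^{(d)}` -/
  u : Fin (T₀ + T₁) → Fin D → Ω → Fin r → ℝ
  /-- unit factor `v_n` -/
  v : Fin N → Ω → Fin r → ℝ
  /-- idiosyncratic shock `ε_{tn}` -/
  shock : Fin (T₀ + T₁) → Fin N → Ω → ℝ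
  /-- potential outcome `Y_{tn}^{(d)}` -/
  potential : Fin D → Fin (T₀ + T₁) → Fin N → Ω → ℝ
  /-- observed outcome `Y_{tn}` -/
  outcome : Fin (T₀ + T₁) → Fin N → Ω → ℝ
  measurable_assign : ∀ n, Measurable (assign n)
  measurable_u : ∀ t d, Measurable (u t d)
  measurable_v : ∀ n, Measurable (v n)
  measurable_shock : ∀ t n, Measurable (shock t n)

namespace Panel

variable {Ω : Type*} [MeasurableSpace Ω] {N T₀ T₁ D r : ℕ}

/-- All latent factors together with all assignments. -/
def latent (S : Panel Ω N T₀ T₁ D r) (ω : Ω) :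
    (Fin (T₀ + T₁) → Fin D → Fin r → ℝ) × (Fin N → Fin r → ℝ) × (Fin N → Fin D) :=
  (fun t d => S.u t d ω, fun n => S.v n ω, fun n => S.assign n ω)

/-- The regular conditional probability given the latent factors and the assignments, at the
value that these take at `ω`. -/
def condLaw [StandardBorelSpace Ω] (S : Panel Ω N T₀ T₁ D r)
    (P : Measure Ω) [IsFiniteMeasure P] (ω : Ω) : Measure Ω :=
  condExpKernel P (MeasurableSpace.comap S.latent inferInstance) ω

/-- Before the intervention point all units are observed under control (intervention `0`),
afterwards under their assigned intervention. -/
def SUTVA [NeZero D] (S : Panel Ω N T₀ T₁ D r) : Prop :=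
  ∀ n ω, (∀ t : Fin T₀, S.outcome (Fin.castAdd T₁ t) n ω =
      S.potential 0 (Fin.castAdd T₁ t) n ω) ∧
    (∀ t : Fin T₁, S.outcome (Fin.natAdd T₀ t) n ω =
      S.potential (S.assign n ω) (Fin.natAdd T₀ t) n ω)

/-- Latent factor model. -/
def FactorModel (S : Panel Ω N T₀ T₁ D r) : Prop :=
  ∀ d t n ω, S.potential d t n ω = S.u t d ω ⬝ᵥ S.v n ω + S.shock t n ω

/-- Conditional mean independence: the shocks have mean zero conditionally on the latent factors
and the assignments. -/
def CondMeanZero [StandardBorelSpace Ω] (S : Panel Ω N T₀ T₁ D r)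
    (P : Measure Ω) [IsFiniteMeasure P] : Prop :=
  ∀ᵐ ω ∂P, ∀ t n, Integrable (S.shock t n) (S.condLaw P ω) ∧
    ∫ ω', S.shock t n ω' ∂(S.condLaw P ω) = 0

/-- Sub-Gaussian shocks: conditionally on the latent factors and the assignments, the shocks are
independent, with second moment `σ²` and sub-Gaussian norm at most `K σ`. -/
def SubGaussianShocks [StandardBorelSpace Ω] (S : Panel Ω N T₀ T₁ D r)
    (P : Measure Ω) [IsFiniteMeasure P] (σ K : ℝ) : Prop :=
  ∀ᵐ ω ∂P,
    iIndepFun (fun p : Fin (T₀ + T₁) × Fin N => S.shock p.1 p.2) (S.condLaw P ω) ∧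
    ∀ t n, ∫ ω', S.shock t n ω' ^ 2 ∂(S.condLaw P ω) = σ ^ 2 ∧
      psiTwoNorm (S.shock t n) (S.condLaw P ω) ≤ ENNReal.ofReal (K * σ)

/-- The set of units that receive intervention `d`. -/
abbrev Donors (S : Panel Ω N T₀ T₁ D r) (d : Fin D) (ω : Ω) : Type :=
  {n : Fin N // S.assign n ω = d}

/-- The number of units that receive intervention `d`. -/
def numDonors (S : Panel Ω N T₀ T₁ D r) (d : Fin D) (ω : Ω) : ℕ :=
  Fintype.card (S.Donors d ω)

/-- Pre-intervention outcomes of the units that receive `d`. -/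
def Ypre (S : Panel Ω N T₀ T₁ D r) (d : Fin D) (ω : Ω) :
    Matrix (Fin T₀) (S.Donors d ω) ℝ :=
  Matrix.of fun t j => S.outcome (Fin.castAdd T₁ t) j ω

/-- Post-intervention outcomes of the units that receive `d`. -/
def Ypost (S : Panel Ω N T₀ T₁ D r) (d : Fin D) (ω : Ω) :
    Matrix (Fin T₁) (S.Donors d ω) ℝ :=
  Matrix.of fun t j => S.outcome (Fin.natAdd T₀ t) j ω

section Mean

variable [StandardBorelSpace Ω] (S : Panel Ω N T₀ T₁ D r) (P : Measure Ω) [IsFiniteMeasure P]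
  (d : Fin D) (ω : Ω)

/-- Conditional expectation of the pre-intervention matrix. -/
def meanPre : Matrix (Fin T₀) (S.Donors d ω) ℝ :=
  Matrix.of fun t j => ∫ ω', S.outcome (Fin.castAdd T₁ t) j ω' ∂(S.condLaw P ω)

/-- Conditional expectation of the post-intervention matrix. -/
def meanPost : Matrix (Fin T₁) (S.Donors d ω) ℝ :=
  Matrix.of fun t j => ∫ ω', S.outcome (Fin.natAdd T₀ t) j ω' ∂(S.condLaw P ω)

/-- Rank of the conditional mean of the pre-intervention matrix. -/
def rPre : ℕ := (S.meanPre P d ω).rank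

/-- Rank of the conditional mean of the post-intervention matrix. -/
def rPost : ℕ := (S.meanPost P d ω).rank

/-- Smallest nonzero singular value of the pre-intervention mean (`0` if the rank is `0`). -/
def sPre : ℝ := singularValue (S.meanPre P d ω) (S.rPre P d ω)

/-- Smallest nonzero singular value of the post-intervention mean (`0` if the rank is `0`). -/
def sPost : ℝ := singularValue (S.meanPost P d ω) (S.rPost P d ω)

/-- The critical value `τ(α)`. -/
def criticalValue (C σ α : ℝ) : ℝ :=
  C * σ ^ 2 * S.rPost P d ω * phi T₀ (S.numDonors d ω) (α / 2) ^ 2 / S.sPre P d ω ^ 2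
  + C * σ ^ 2 * S.rPost P d ω * phi T₁ (S.numDonors d ω) (α / 2) ^ 2 / S.sPost P d ω ^ 2
  + C * σ * S.rPost P d ω * phi T₀ (S.numDonors d ω) (α / 2) / S.sPre P d ω

end Mean

end Panel

end

/-! Outside two sets of conditional probability at most α/2 each, both noise matrices `Y - M` have
operator norm at most e = 12Kσφ(α/2). The rest is deterministic linear algebra.

Noise: a centred variable with ψ₂-norm at most s is sub-Gaussian with parameter 2s², so each form
⟨y, εx⟩ with unit x, y has Gaussian tails. A union bound over 1/2-nets of the two spheres gives
`measure_not_opNormLE_le`.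

Perturbation: let `M` have rank k. On the orthogonal complement of the top k right singular vectors
of `Y`, `Y` is bounded by e. There s‖Py‖ ≤ ‖My‖ ≤ 2e‖y‖, with P the projection onto the row space of
`M` and s its least nonzero singular value. So the true and the estimated subspaces are within 2e/s
of each other, in both directions since their dimensions agree.

Write δ and ε for these distances before and after the intervention, and r for the rank of the
post-intervention mean. Under alignment the statistic is at most 2r(δ² + ε²), which the two
quadratic terms of τ(α) dominate. In general the population statistic r - ‖VV'W‖² exceeds the
estimated one by at most 3r(δ + ε); the linear term of τ(α) and the extra term of the separation
condition absorb this.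

Conditioning: almost surely the conditional law at ω lives on the fibre of the latent variables
through ω, where means, ranks and critical value are constant and outcome minus conditional mean is
the shock. -/

/-! ### Min-max lower bound for singular values -/

open Module InnerProductSpace in
theorem le_singularValues_of_le_norm {E F : Type*} [NormedAddCommGroup E] [InnerProductSpace ℝ E]
    [FiniteDimensional ℝ E] [NormedAddCommGroup F] [InnerProductSpace ℝ F] [FiniteDimensional ℝ F]
    (T : E →ₗ[ℝ] F) {U : Submodule ℝ E} {j : ℕ} (hj : j < finrank ℝ U) {μ : ℝ}
    (h : ∀ x ∈ U, μ * ‖x‖ ≤ ‖T x‖) : μ ≤ T.singularValues j := by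
  have hjn : j < finrank ℝ E := hj.trans_le U.finrank_le
  have hT := T.isSymmetric_adjoint_comp_self
  set b := hT.eigenvectorBasis rfl with hb
  -- As `U` has dimension above `j`, it contains a nonzero vector orthogonal to the first `j`
  -- eigenvectors; on it `T` stretches by at most the singular value of (zero-based) index `j`.
  let L : U →ₗ[ℝ] (Fin j → ℝ) :=
    LinearMap.pi fun i => (innerₛₗ ℝ (b ⟨i, i.2.trans hjn⟩)).comp U.subtype
  obtain ⟨⟨x, hxU⟩, hxL, hx0⟩ := (Submodule.ne_bot_iff _).1
    (L.ker_ne_bot_of_finrank_lt (by simpa using hj))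
  have hx0' : 0 < ‖x‖ := norm_pos_iff.2 fun h0 => hx0 (Subtype.ext h0)
  have hlow : ∀ i : Fin (finrank ℝ E), (i : ℕ) < j → inner ℝ (b i) x = 0 := by
    intro i hi
    exact congrFun (LinearMap.mem_ker.1 hxL) ⟨i, hi⟩
  have key : ‖T x‖ ^ 2 ≤ T.singularValues j ^ 2 * ‖x‖ ^ 2 := by
    have h1 : ‖T x‖ ^ 2 = ∑ i : Fin (finrank ℝ E), T.singularValues i ^ 2 * inner ℝ (b i) x ^ 2 := by
      rw [← real_inner_self_eq_norm_sq, ← LinearMap.adjoint_inner_right,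
        ← b.sum_inner_mul_inner]
      refine Finset.sum_congr rfl fun i _ => ?_
      have h2 : inner ℝ (b i) (T.adjoint (T x)) = T.singularValues i ^ 2 * inner ℝ (b i) x := by
        have := hT (b i) x
        rw [LinearMap.comp_apply, LinearMap.comp_apply] at this
        rw [← this]
        have h3 := hT.apply_eigenvectorBasis rfl i
        rw [LinearMap.comp_apply] at h3
        rw [hb, h3, inner_smul_left, T.sq_singularValues_fin rfl]
        simp
      rw [h2, real_inner_comm]
      ring
    rw [h1, ← b.sum_sq_inner_right x, Finset.mul_sum]
    refine Finset.sum_le_sum fun i _ => ?_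
    by_cases hi : (i : ℕ) < j
    · simp [hlow i hi]
    · gcongr
      · exact T.singularValues_nonneg _
      · exact T.singularValues_antitone (not_lt.1 hi)
  have h4 : ‖T x‖ ≤ T.singularValues j * ‖x‖ := by
    refine le_of_sq_le_sq ?_ (mul_nonneg (T.singularValues_nonneg _) (norm_nonneg _))
    rwa [mul_pow]
  exact le_of_mul_le_mul_right ((h x hxU).trans h4) hx0'

/-! ### Low-rank perturbation and top singular vectors -/

section Perturbation

open Module

variable {E F : Type*} [NormedAddCommGroup E] [InnerProductSpace ℝ E] [FiniteDimensional ℝ E]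
  [NormedAddCommGroup F] [InnerProductSpace ℝ F] [FiniteDimensional ℝ F]

/-- `v` consists of orthonormal right singular vectors for the largest singular values of `T`. -/
structure IsTopSingularFamily {k : ℕ} (T : E →ₗ[ℝ] F) (v : Fin k → E) : Prop where
  orthonormal : Orthonormal ℝ v
  eigen : ∀ i, T.adjoint (T (v i)) = T.singularValues i ^ 2 • v i

variable {k : ℕ} {T M : E →ₗ[ℝ] F} {v w : Fin k → E}

/-- Pythagoras: since each `v i` is an eigenvector of `T.adjoint ∘ T`, the images `T (v i)` are
orthogonal to each other and to `T y`. -/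
theorem IsTopSingularFamily.norm_map_sq (h : IsTopSingularFamily T v) (c : Fin k → ℝ) {y : E}
    (hy : ∀ i, inner ℝ (v i) y = 0) :
    ‖T (∑ i, c i • v i + y)‖ ^ 2 = ∑ i : Fin k, T.singularValues i ^ 2 * c i ^ 2 + ‖T y‖ ^ 2 := by
  have h1 : ∀ i x, inner ℝ (T (v i)) (T x) = T.singularValues i ^ 2 * inner ℝ (v i) x := by
    intro i x
    rw [← LinearMap.adjoint_inner_left, h.eigen, inner_smul_left]
    simp
  have h2 : ∀ x, inner ℝ (T (∑ i, c i • v i)) (T x)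
      = ∑ i, c i * (T.singularValues i ^ 2 * inner ℝ (v i) x) := by
    intro x
    rw [map_sum, sum_inner]
    refine Finset.sum_congr rfl fun i _ => ?_
    rw [map_smul, inner_smul_left, h1]
    simp
  rw [map_add, norm_add_sq_real, ← real_inner_self_eq_norm_sq (T (∑ i, c i • v i)), h2, h2]
  simp only [hy, h.orthonormal.inner_right_fintype]
  simp
  exact Finset.sum_congr rfl fun i _ => by ring

omit [FiniteDimensional ℝ E] in
theorem norm_sum_smul_add_sq (h : Orthonormal ℝ v) (c : Fin k → ℝ) {y : E}
    (hy : ∀ i, inner ℝ (v i) y = 0) :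
    ‖∑ i, c i • v i + y‖ ^ 2 = ∑ i, c i ^ 2 + ‖y‖ ^ 2 := by
  have h2 : ∀ x, inner ℝ (∑ i, c i • v i) x = ∑ i, c i * inner ℝ (v i) x := by
    intro x
    rw [sum_inner]
    exact Finset.sum_congr rfl fun i _ => by rw [inner_smul_left]; simp
  rw [norm_add_sq_real, ← real_inner_self_eq_norm_sq (∑ i, c i • v i), h2, h2]
  simp only [hy, h.inner_right_fintype]
  simp
  exact Finset.sum_congr rfl fun i _ => by ring

/-- The parametrization `(c, a) ↦ ∑ cᵢ vᵢ + a y`. -/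
noncomputable def familyMap (v : Fin k → E) (y : E) : (Fin k → ℝ) × ℝ →ₗ[ℝ] E :=
  (Fintype.linearCombination ℝ v).coprod (LinearMap.toSpanSingleton ℝ E y)

omit [FiniteDimensional ℝ E] in
theorem familyMap_apply (v : Fin k → E) (y : E) (c : (Fin k → ℝ) × ℝ) :
    familyMap v y c = ∑ i, c.1 i • v i + c.2 • y := by
  simp [familyMap, Fintype.linearCombination_apply]

omit [FiniteDimensional ℝ E] in
theorem familyMap_injective (h : Orthonormal ℝ v) {y : E} (hy0 : y ≠ 0)
    (hy : ∀ i, inner ℝ (v i) y = 0) : Function.Injective (familyMap v y) := by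
  rw [← LinearMap.ker_eq_bot, LinearMap.ker_eq_bot']
  intro c hc
  have h1 := norm_sum_smul_add_sq h c.1 (y := c.2 • y) (by simp [inner_smul_right, hy])
  rw [← familyMap_apply, hc, norm_zero, norm_smul, mul_pow] at h1
  have h2 : 0 ≤ ∑ i, c.1 i ^ 2 := Finset.sum_nonneg fun i _ => sq_nonneg _
  have hyp : 0 < ‖y‖ := norm_pos_iff.2 hy0
  have h3 : ‖c.2‖ ^ 2 * ‖y‖ ^ 2 = 0 := by
    have : 0 ≤ ‖c.2‖ ^ 2 * ‖y‖ ^ 2 := by positivity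
    linarith
  have h4 : ∑ i, c.1 i ^ 2 = 0 := by linarith
  refine Prod.ext (funext fun i => ?_) ?_
  · exact pow_eq_zero_iff two_ne_zero |>.1
      ((Finset.sum_eq_zero_iff_of_nonneg fun i _ => sq_nonneg _).1 h4 i (Finset.mem_univ i))
  · have h5 : ‖c.2‖ ^ 2 = 0 := (mul_eq_zero.1 h3).resolve_right (by positivity)
    simpa using h5

theorem IsTopSingularFamily.le_norm_map_familyMap (h : IsTopSingularFamily T v) {ρ : ℝ}
    (hρ0 : 0 ≤ ρ) (hρ : ∀ i : Fin k, ρ ≤ T.singularValues i) {y : E}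
    (hy : ∀ i, inner ℝ (v i) y = 0) (hTy : ρ * ‖y‖ ≤ ‖T y‖) (c : (Fin k → ℝ) × ℝ) :
    ρ * ‖familyMap v y c‖ ≤ ‖T (familyMap v y c)‖ := by
  have hy' : ∀ i, inner ℝ (v i) (c.2 • y) = 0 := by simp [inner_smul_right, hy]
  refine le_of_sq_le_sq ?_ (norm_nonneg _)
  rw [mul_pow, familyMap_apply, norm_sum_smul_add_sq h.orthonormal _ hy', h.norm_map_sq _ hy',
    mul_add, Finset.mul_sum]
  refine add_le_add (Finset.sum_le_sum fun i _ => ?_) ?_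
  · gcongr
    exact hρ i
  · rw [← mul_pow, map_smul, norm_smul, norm_smul]
    refine pow_le_pow_left₀ (by positivity) ?_ 2
    calc ρ * (‖c.2‖ * ‖y‖) = ‖c.2‖ * (ρ * ‖y‖) := by ring
      _ ≤ _ := by gcongr

theorem IsTopSingularFamily.castLE (h : IsTopSingularFamily T v) {j : ℕ} (hj : j ≤ k) :
    IsTopSingularFamily T (v ∘ Fin.castLE hj) :=
  ⟨h.orthonormal.comp _ (Fin.castLE_injective hj), fun i => h.eigen (Fin.castLE hj i)⟩

omit [FiniteDimensional ℝ E] in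
theorem finrank_range_familyMap (h : Orthonormal ℝ v) {y : E} (hy0 : y ≠ 0)
    (hy : ∀ i, inner ℝ (v i) y = 0) : finrank ℝ (familyMap v y).range = k + 1 := by
  rw [LinearMap.finrank_range_of_inj (familyMap_injective h hy0 hy)]
  simp

/-- If `T` is within `e` of a map of rank at most `k`, then `T` is bounded by `e` on the orthogonal
complement of its top `k` right singular vectors. -/
theorem IsTopSingularFamily.norm_map_le_of_orthogonal (h : IsTopSingularFamily T v) {e : ℝ}
    (he : 0 ≤ e) (hM : finrank ℝ M.range ≤ k) (hTM : ∀ x, ‖T x - M x‖ ≤ e * ‖x‖) {y : E}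
    (hy : ∀ i, inner ℝ (v i) y = 0) : ‖T y‖ ≤ e * ‖y‖ := by
  rcases eq_or_ne y 0 with rfl | hy0
  · simp
  have hyp : 0 < ‖y‖ := norm_pos_iff.2 hy0
  by_contra! hlt
  set ρ := ‖T y‖ / ‖y‖ with hρ
  have hTy : ρ * ‖y‖ ≤ ‖T y‖ := by rw [hρ, div_mul_cancel₀ _ hyp.ne']
  have heρ : e < ρ := by rw [hρ, lt_div_iff₀ hyp]; exact hlt
  have hρ0 : 0 ≤ ρ := he.trans heρ.le
  -- The hypotheses do not say directly that `y` is stretched no more than the `v i`. Min-max gives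
  -- it by induction: `T` stretches the span of the first `j` vectors and `y`, of dimension `j + 1`,
  -- by at least `ρ`.
  have hsv : ∀ j ≤ k, ∀ i : Fin j, ρ ≤ T.singularValues i := by
    intro j
    induction j with
    | zero => intro _ i; exact i.elim0
    | succ j ih =>
      intro hj
      have hcast := h.castLE (j := j) (by omega)
      have hyc : ∀ i, inner ℝ ((v ∘ Fin.castLE (by omega : j ≤ k)) i) y = 0 := fun i => hy _
      refine Fin.lastCases ?_ (ih (by omega))
      refine le_singularValues_of_le_norm T 
        (U := (familyMap (v ∘ Fin.castLE (by omega : j ≤ k)) y).range) (j := j) ?_ ?_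
      · rw [finrank_range_familyMap hcast.orthonormal hy0 hyc]
        omega
      · rintro _ ⟨c, rfl⟩
        exact hcast.le_norm_map_familyMap hρ0 (ih (by omega)) hyc hTy c
  -- The span of `v` and `y` has dimension `k + 1`, so `M` kills a nonzero vector of it. There `T =
  -- T - M` is at most `e`, yet at least `ρ > e`.
  have hlt : finrank ℝ M.range < finrank ℝ ((Fin k → ℝ) × ℝ) := by
    simpa using Nat.lt_succ_of_le hM
  obtain ⟨c, hc, hc0⟩ := (Submodule.ne_bot_iff _).1
    ((M.rangeRestrict.comp (familyMap v y)).ker_ne_bot_of_finrank_lt hlt)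
  have hMc : M (familyMap v y c) = 0 := congrArg Subtype.val (LinearMap.mem_ker.1 hc)
  have hne : familyMap v y c ≠ 0 := fun h0 =>
    hc0 (familyMap_injective h.orthonormal hy0 hy (by simpa using h0))
  have h1 := h.le_norm_map_familyMap hρ0 (hsv k le_rfl) hy hTy c
  have h2 := hTM (familyMap v y c)
  rw [hMc, sub_zero] at h2
  exact absurd (le_of_mul_le_mul_right (h1.trans h2) (norm_pos_iff.2 hne)) (not_le.2 heρ)

end Perturbation

/-! ### Orthogonal projections and one-sided distances between subspaces -/

section Projections

open Module Submodule

variable {E F : Type*} [NormedAddCommGroup E] [InnerProductSpace ℝ E] [FiniteDimensional ℝ E]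
  [NormedAddCommGroup F] [InnerProductSpace ℝ F] [FiniteDimensional ℝ F]
  {k : ℕ} {T M : E →ₗ[ℝ] F} {v w : Fin k → E}

theorem starProjection_span_range {ι : Type*} [Fintype ι] {v : ι → E} (hv : Orthonormal ℝ v)
    (x : E) : (span ℝ (Set.range v)).starProjection x = ∑ i, inner ℝ (v i) x • v i := by
  refine eq_starProjection_of_mem_of_inner_eq_zero
    (sum_mem fun i _ => smul_mem _ _ (subset_span ⟨i, rfl⟩)) fun y hy => ?_
  classical
  induction hy using span_induction with
  | mem y hy =>
    obtain ⟨i, rfl⟩ := hy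
    rw [inner_sub_left, sum_inner]
    simp [inner_smul_left, orthonormal_iff_ite.1 hv, real_inner_comm]
  | zero => simp
  | add y z _ _ hy hz => rw [inner_add_right, hy, hz, add_zero]
  | smul a y _ hy => rw [inner_smul_right, hy, mul_zero]

theorem IsTopSingularFamily.norm_starProjection_le (h : IsTopSingularFamily M v) {s : ℝ}
    (hs : 0 ≤ s) (hsk : ∀ i : Fin k, s ≤ M.singularValues i) (y : E) :
    s * ‖(span ℝ (Set.range v)).starProjection y‖ ≤ ‖M y‖ := by
  set P := (span ℝ (Set.range v)).starProjection y with hP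
  have horth : ∀ i, inner ℝ (v i) (y - P) = 0 := fun i => by
    rw [hP, real_inner_comm]
    exact starProjection_inner_eq_zero _ _ (subset_span ⟨i, rfl⟩)
  have h1 := h.norm_map_sq (fun i => inner ℝ (v i) y) horth
  have h2 := norm_sum_smul_add_sq h.orthonormal (fun i => inner ℝ (v i) y) (y := 0) (by simp)
  rw [← starProjection_span_range h.orthonormal] at h1 h2
  simp only [← hP, add_zero, norm_zero, add_sub_cancel] at h1 h2
  refine le_of_sq_le_sq ?_ (norm_nonneg _)
  rw [zero_pow two_ne_zero, add_zero] at h2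
  rw [mul_pow, h1, h2, Finset.mul_sum]
  refine le_add_of_le_of_nonneg (Finset.sum_le_sum fun i _ => ?_) (sq_nonneg _)
  gcongr
  exact hsk i

omit [FiniteDimensional ℝ E] in
theorem norm_sub_starProjection_sq (K : Submodule ℝ E) [K.HasOrthogonalProjection] (x : E) :
    ‖x - K.starProjection x‖ ^ 2 = ‖x‖ ^ 2 - ‖K.starProjection x‖ ^ 2 := by
  have h : inner ℝ x (K.starProjection x) = ‖K.starProjection x‖ ^ 2 := by
    rw [← real_inner_self_eq_norm_sq, ← sub_eq_zero, ← inner_sub_left]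
    exact starProjection_inner_eq_zero _ _ (starProjection_apply_mem K x)
  rw [norm_sub_sq_real, h]
  ring

omit [FiniteDimensional ℝ E] in
theorem norm_sub_starProjection_le (K : Submodule ℝ E) [K.HasOrthogonalProjection] (x : E) :
    ‖x - K.starProjection x‖ ≤ ‖x‖ := by
  refine le_of_sq_le_sq ?_ (norm_nonneg _)
  rw [norm_sub_starProjection_sq]
  linarith [sq_nonneg ‖K.starProjection x‖]

/-- Duality: the projection onto `Lᗮ` restricted to `K` is the adjoint of the projection onto `K`
restricted to `Lᗮ`, so the two have the same norm. -/
theorem norm_sub_starProjection_le_of_orthogonal {K L : Submodule ℝ E} {δ : ℝ} (hδ : 0 ≤ δ)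
    (h : ∀ y ∈ Lᗮ, ‖K.starProjection y‖ ≤ δ * ‖y‖) {x : E} (hx : x ∈ K) :
    ‖x - L.starProjection x‖ ≤ δ * ‖x‖ := by
  set z := x - L.starProjection x with hz
  have hzL : z ∈ Lᗮ := sub_starProjection_mem_orthogonal x
  have h1 : inner ℝ (K.starProjection z) x = ‖z‖ ^ 2 := by
    rw [inner_starProjection_left_eq_right, starProjection_eq_self_iff.2 hx,
      ← real_inner_self_eq_norm_sq, ← sub_eq_zero, ← inner_sub_right, hz, sub_sub_cancel,
      real_inner_comm]
    exact inner_right_of_mem_orthogonal (starProjection_apply_mem L x) hzL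
  have h2 := h1 ▸ real_inner_le_norm _ _
  rcases (norm_nonneg z).eq_or_lt with h0 | h0
  · rw [← h0]
    positivity
  · refine le_of_mul_le_mul_right ?_ h0
    calc ‖z‖ * ‖z‖ = ‖z‖ ^ 2 := by ring
      _ ≤ ‖K.starProjection z‖ * ‖x‖ := h2
      _ ≤ δ * ‖z‖ * ‖x‖ := by gcongr; exact h z hzL
      _ = _ := by ring

/-- The one-sided distance between subspaces of the same dimension is symmetric. -/
theorem norm_sub_starProjection_le_symm {K L : Submodule ℝ E} (hKL : finrank ℝ K = finrank ℝ L)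
    {δ : ℝ} (hδ : 0 ≤ δ) (h : ∀ x ∈ K, ‖x - L.starProjection x‖ ≤ δ * ‖x‖) {w : E} (hw : w ∈ L) :
    ‖w - K.starProjection w‖ ≤ δ * ‖w‖ := by
  rcases le_or_gt 1 δ with h1 | h1
  · exact (norm_sub_starProjection_le K w).trans (le_mul_of_one_le_left (norm_nonneg _) h1)
  -- For `δ < 1` the projection from `K` to `L` is injective, hence onto by equality of dimensions.
  -- Each `w` in `L` is then the projection of some `x` in `K`, which bounds the projection of `w`
  -- to `K` from below.
  let φ : K →ₗ[ℝ] L := (L.orthogonalProjectionOnto : E →ₗ[ℝ] L).comp K.subtype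
  have hφ : ∀ x, (φ x : E) = L.starProjection x := fun x => rfl
  have hinj : Function.Injective φ := by
    rw [← LinearMap.ker_eq_bot, LinearMap.ker_eq_bot']
    intro x hx
    have h2 := h x x.2
    rw [← hφ, hx] at h2
    simp only [ZeroMemClass.coe_zero, sub_zero] at h2
    have : ‖(x : E)‖ = 0 := by nlinarith [norm_nonneg (x : E)]
    simpa using this
  obtain ⟨x, hx⟩ := (LinearMap.injective_iff_surjective_of_finrank_eq_finrank hKL).1 hinj ⟨w, hw⟩
  have hxw : L.starProjection (x : E) = w := by rw [← hφ, hx]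
  have h2 := h x x.2
  have h3 : (1 - δ ^ 2) * ‖(x : E)‖ ^ 2 ≤ ‖w‖ ^ 2 := by
    have h4 := norm_sub_starProjection_sq L (x : E)
    have h5 := pow_le_pow_left₀ (norm_nonneg _) h2 2
    rw [hxw] at h4 h5
    rw [h4, mul_pow] at h5
    linarith
  have h6 : ‖w‖ ^ 2 ≤ ‖K.starProjection w‖ * ‖(x : E)‖ := by
    have h7 : inner ℝ (K.starProjection w) (x : E) = ‖w‖ ^ 2 := by
      rw [inner_starProjection_left_eq_right, starProjection_eq_self_iff.2 x.2,
        ← real_inner_self_eq_norm_sq]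
      nth_rw 1 [← starProjection_eq_self_iff.2 hw]
      rw [inner_starProjection_left_eq_right, hxw]
    exact h7 ▸ real_inner_le_norm _ _
  have hδ2 : 0 < 1 - δ ^ 2 := by nlinarith
  have h8 : (1 - δ ^ 2) * ‖w‖ ^ 2 ≤ ‖K.starProjection w‖ ^ 2 := by
    rcases eq_or_ne w 0 with rfl | hw0
    · simp
    have hwp : 0 < ‖w‖ ^ 2 := by have := norm_pos_iff.2 hw0; positivity
    have h9 := pow_le_pow_left₀ (by positivity) h6 2
    refine le_of_mul_le_mul_right ?_ hwp
    calc (1 - δ ^ 2) * ‖w‖ ^ 2 * ‖w‖ ^ 2 = (1 - δ ^ 2) * (‖w‖ ^ 2) ^ 2 := by ring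
      _ ≤ (1 - δ ^ 2) * (‖K.starProjection w‖ * ‖(x : E)‖) ^ 2 := by gcongr
      _ = ‖K.starProjection w‖ ^ 2 * ((1 - δ ^ 2) * ‖(x : E)‖ ^ 2) := by ring
      _ ≤ _ := by gcongr
  refine le_of_sq_le_sq ?_ (by positivity)
  rw [norm_sub_starProjection_sq, mul_pow]
  linarith

end Projections

/-! ### Distances between singular subspaces and their effect on the statistic -/

section SubspaceComparison

open Module Submodule

variable {E F : Type*} [NormedAddCommGroup E] [InnerProductSpace ℝ E] [FiniteDimensional ℝ E]
  [NormedAddCommGroup F] [InnerProductSpace ℝ F] [FiniteDimensional ℝ F]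

/-- Perturbation bound for the span of the leading right singular vectors: `M` has rank `k`, and
`T` is within `e` of `M`. -/
theorem IsTopSingularFamily.norm_sub_starProjection_le {k : ℕ} {T M : E →ₗ[ℝ] F}
    {v v' : Fin k → E} (hv : IsTopSingularFamily M v) (hv' : IsTopSingularFamily T v')
    (hM : finrank ℝ M.range = k) {e : ℝ} (he : 0 ≤ e) (hTM : ∀ x, ‖T x - M x‖ ≤ e * ‖x‖) {x : E}
    (hx : x ∈ span ℝ (Set.range v)) :
    ‖x - (span ℝ (Set.range v')).starProjection x‖
      ≤ 2 * e / M.singularValues (k - 1) * ‖x‖ := by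
  have hs := M.singularValues_nonneg (k - 1)
  refine norm_sub_starProjection_le_of_orthogonal (by positivity) (fun y hy => ?_) hx
  -- For `k = 0` the index `k - 1` is truncated to `0`; the span is trivial and only nonnegativity
  -- of the bound is needed.
  rcases Nat.eq_zero_or_pos k with rfl | hk
  · have : span ℝ (Set.range v) = ⊥ := by simp [Set.range_eq_empty]
    rw [this]
    simp only [starProjection_bot, _root_.zero_apply, norm_zero]
    positivity
  · have hpos : 0 < M.singularValues (k - 1) := by
      rw [M.singularValues_pos_iff_lt_finrank_range]
      omega
    have hy' : ∀ i, inner ℝ (v' i) y = 0 := fun i =>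
      inner_right_of_mem_orthogonal (subset_span (Set.mem_range_self i)) hy
    have h1 := hv'.norm_map_le_of_orthogonal he hM.le hTM hy'
    have h2 := hv.norm_starProjection_le hs
      (fun i => M.singularValues_antitone (by omega)) y
    have h3 : ‖M y‖ ≤ ‖T y‖ + ‖T y - M y‖ := norm_le_norm_add_norm_sub _ _
    rw [div_mul_eq_mul_div, le_div_iff₀ hpos]
    linarith [hTM y]

theorem IsTopSingularFamily.norm_sub_starProjection_le' {k : ℕ} {T M : E →ₗ[ℝ] F}
    {v v' : Fin k → E} (hv : IsTopSingularFamily M v) (hv' : IsTopSingularFamily T v')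
    (hM : finrank ℝ M.range = k) {e : ℝ} (he : 0 ≤ e) (hTM : ∀ x, ‖T x - M x‖ ≤ e * ‖x‖) {x : E}
    (hx : x ∈ span ℝ (Set.range v')) :
    ‖x - (span ℝ (Set.range v)).starProjection x‖
      ≤ 2 * e / M.singularValues (k - 1) * ‖x‖ := by
  have hs := M.singularValues_nonneg (k - 1)
  refine norm_sub_starProjection_le_symm ?_ (by positivity)
    (fun _ h => hv.norm_sub_starProjection_le hv' hM he hTM h) hx
  rw [finrank_span_eq_card hv.orthonormal.linearIndependent,
    finrank_span_eq_card hv'.orthonormal.linearIndependent]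

variable {l : ℕ} {K K' L L' : Submodule ℝ E} {w w' : Fin l → E} {δ ε : ℝ}

/-- The null case: `w' j` is within `ε` of `L ≤ K`, and its projection to `K` is within `δ` of `K'`.
The error enters squared because the unperturbed statistic is zero. -/
theorem sum_norm_sub_starProjection_sq_le_of_le (hw' : Orthonormal ℝ w') (hδ : 0 ≤ δ)
    (hL' : ∀ j, w' j ∈ L') (hLK : L ≤ K)
    (hK : ∀ x ∈ K, ‖x - K'.starProjection x‖ ≤ δ * ‖x‖)
    (hL : ∀ x ∈ L', ‖x - L.starProjection x‖ ≤ ε * ‖x‖) :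
    ∑ j, ‖w' j - K'.starProjection (w' j)‖ ^ 2 ≤ 2 * l * (δ ^ 2 + ε ^ 2) := by
  have key : ∀ j, ‖w' j - K'.starProjection (w' j)‖ ^ 2 ≤ 2 * (δ ^ 2 + ε ^ 2) := by
    intro j
    set x := w' j with hx
    have hx1 : ‖x‖ = 1 := hw'.1 j
    have h1 : ‖K.starProjection x - K'.starProjection (K.starProjection x)‖ ≤ δ := by
      refine (hK _ (starProjection_apply_mem K x)).trans (mul_le_of_le_one_right hδ ?_)
      exact hx1 ▸ norm_starProjection_apply_le K x
    have h2 : ‖x - K.starProjection x‖ ≤ ε := by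
      have h3 : x - K.starProjection x
          = (x - L.starProjection x) - K.starProjection (x - L.starProjection x) := by
        rw [map_sub, starProjection_eq_self_iff.2 (hLK (starProjection_apply_mem L x))]
        abel
      rw [h3]
      refine (_root_.norm_sub_starProjection_le K _).trans ?_
      simpa [hx1] using hL x (hL' j)
    have h4 : x - K'.starProjection x
        = (K.starProjection x - K'.starProjection (K.starProjection x))
          + ((x - K.starProjection x) - K'.starProjection (x - K.starProjection x)) := by
      rw [map_sub]
      abel
    have h5 : ‖x - K'.starProjection x‖ ≤ δ + ε := by
      rw [h4]
      exact (norm_add_le _ _).trans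
        (add_le_add h1 ((_root_.norm_sub_starProjection_le K' _).trans h2))
    calc _ ≤ (δ + ε) ^ 2 := pow_le_pow_left₀ (norm_nonneg _) h5 2
      _ ≤ _ := by linarith [sq_nonneg (δ - ε)]
  calc _ ≤ ∑ _j : Fin l, 2 * (δ ^ 2 + ε ^ 2) := Finset.sum_le_sum fun j _ => key j
    _ = _ := by simp; ring

theorem norm_add_sq_le_add_three_mul {E : Type*} [SeminormedAddCommGroup E] {x y : E} {ε : ℝ} (hx : ‖x‖ ≤ 1) (hy1 : ‖y‖ ≤ 1)
    (hy : ‖y‖ ≤ ε) : ‖x + y‖ ^ 2 ≤ ‖x‖ ^ 2 + 3 * ε := by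
  have h1 := pow_le_pow_left₀ (norm_nonneg _) (norm_add_le x y) 2
  nlinarith [norm_nonneg x, norm_nonneg y]

/-- A Hilbert-Schmidt norm does not increase under precomposition with an orthogonal projection. -/
theorem sum_norm_map_starProjection_sq_le (hw : Orthonormal ℝ w) (hw' : Orthonormal ℝ w')
    (X : E →ₗ[ℝ] E) :
    ∑ j, ‖X ((span ℝ (Set.range w')).starProjection (w j))‖ ^ 2 ≤ ∑ j, ‖X (w' j)‖ ^ 2 := by
  set Q := (span ℝ (Set.range w')).starProjection with hQ
  let b := stdOrthonormalBasis ℝ E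
  have h1 : ∀ x, ‖X x‖ ^ 2 = ∑ a, inner ℝ (X.adjoint (b a)) x ^ 2 := by
    intro x
    rw [← b.sum_sq_inner_right]
    exact Finset.sum_congr rfl fun a _ => by rw [LinearMap.adjoint_inner_left]
  simp only [h1]
  rw [Finset.sum_comm]
  refine Eq.trans_ge Finset.sum_comm ?_
  refine Finset.sum_le_sum fun a _ => ?_
  set z := X.adjoint (b a)
  calc ∑ j, inner ℝ z (Q (w j)) ^ 2 = ∑ j, ‖inner ℝ (w j) (Q z)‖ ^ 2 := by
        refine Finset.sum_congr rfl fun j _ => ?_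
        rw [← inner_starProjection_left_eq_right, real_inner_comm, Real.norm_eq_abs, sq_abs]
    _ ≤ ‖Q z‖ ^ 2 := hw.sum_inner_products_le _
    _ = ∑ j, inner ℝ (w' j) z ^ 2 := by
        have h2 := norm_sum_smul_add_sq hw' (fun j => inner ℝ (w' j) z) (y := 0) (by simp)
        rw [← starProjection_span_range hw'] at h2
        simpa [hQ] using h2
    _ = _ := Finset.sum_congr rfl fun j _ => by rw [real_inner_comm]

/-- The families `w` and `w'` are not matched vector by vector, only their spans are close. So `w j`
is first replaced by its projection to the span of `w'`, and the Hilbert-Schmidt inequality passes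
to `w'`; each replacement costs three times the distance per vector. -/
theorem sum_norm_sub_starProjection_sq_le_add (hw : Orthonormal ℝ w) (hw' : Orthonormal ℝ w')
    (hδ : 0 ≤ δ)
    (hK : ∀ x ∈ K', ‖x - K.starProjection x‖ ≤ δ * ‖x‖)
    (hL : ∀ x ∈ span ℝ (Set.range w),
      ‖x - (span ℝ (Set.range w')).starProjection x‖ ≤ ε * ‖x‖) :
    ∑ j, ‖w j - K.starProjection (w j)‖ ^ 2
      ≤ ∑ j, ‖w' j - K'.starProjection (w' j)‖ ^ 2 + 3 * l * (δ + ε) := by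
  set Q := (span ℝ (Set.range w')).starProjection with hQ
  let X : E →ₗ[ℝ] E := LinearMap.id - K.starProjection.toLinearMap
  have hX : ∀ x, X x = x - K.starProjection x := fun x => rfl
  have hXle : ∀ x, ‖X x‖ ≤ ‖x‖ := fun x => _root_.norm_sub_starProjection_le K x
  have h1 : ∀ j, ‖X (w j)‖ ^ 2 ≤ ‖X (Q (w j))‖ ^ 2 + 3 * ε := by
    intro j
    have h : X (w j) = X (Q (w j)) + X (w j - Q (w j)) := by rw [← map_add, add_sub_cancel]
    rw [h]
    have hwj : ‖w j‖ = 1 := hw.1 j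
    refine norm_add_sq_le_add_three_mul ?_ ?_ ?_
    · exact (hXle _).trans (hwj ▸ norm_starProjection_apply_le _ _)
    · exact (hXle _).trans (hwj ▸ _root_.norm_sub_starProjection_le _ _)
    · refine (hXle _).trans ?_
      simpa [hwj] using hL (w j) (subset_span ⟨j, rfl⟩)
  have h2 : ∀ j, ‖X (w' j)‖ ^ 2 ≤ ‖w' j - K'.starProjection (w' j)‖ ^ 2 + 3 * δ := by
    intro j
    have hwj : ‖w' j‖ = 1 := hw'.1 j
    have h : X (w' j) = X (w' j - K'.starProjection (w' j)) + X (K'.starProjection (w' j)) := by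
      rw [← map_add, sub_add_cancel]
    have hp : ‖K'.starProjection (w' j)‖ ≤ 1 := hwj ▸ norm_starProjection_apply_le _ _
    have h3 : ‖X (w' j)‖ ^ 2 ≤ ‖X (w' j - K'.starProjection (w' j))‖ ^ 2 + 3 * δ := by
      rw [h]
      refine norm_add_sq_le_add_three_mul ?_ ((hXle _).trans hp) ?_
      · exact (hXle _).trans (hwj ▸ _root_.norm_sub_starProjection_le _ _)
      · exact (hK _ (starProjection_apply_mem K' _)).trans (mul_le_of_le_one_right hδ hp)
    refine h3.trans (add_le_add_left (pow_le_pow_left₀ (norm_nonneg _) (hXle _) 2) _)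
  calc _ = ∑ j, ‖X (w j)‖ ^ 2 := rfl
    _ ≤ ∑ j, (‖X (Q (w j))‖ ^ 2 + 3 * ε) := Finset.sum_le_sum fun j _ => h1 j
    _ = ∑ j, ‖X (Q (w j))‖ ^ 2 + 3 * l * ε := by
        rw [Finset.sum_add_distrib]; simp; ring
    _ ≤ ∑ j, ‖X (w' j)‖ ^ 2 + 3 * l * ε := 
        add_le_add_left (sum_norm_map_starProjection_sq_le hw hw' X) _
    _ ≤ ∑ j, (‖w' j - K'.starProjection (w' j)‖ ^ 2 + 3 * δ) + 3 * l * ε := by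
        gcongr with j; exact h2 j
    _ = _ := by rw [Finset.sum_add_distrib]; simp; ring

end SubspaceComparison

/-! ### From matrices to linear maps of Euclidean spaces -/

section MatrixBridge

open Module Submodule

variable {m n : Type*} [Fintype m] [Fintype n] [DecidableEq n] {k l : ℕ}

/-- The columns of a matrix as vectors of the Euclidean space. -/
noncomputable def euclideanCol (V : Matrix n (Fin k) ℝ) (i : Fin k) : EuclideanSpace ℝ n :=
  WithLp.toLp 2 (V.col i)

omit [DecidableEq n] in
theorem inner_euclideanCol (V : Matrix n (Fin k) ℝ) (i : Fin k) (x : EuclideanSpace ℝ n) :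
    inner ℝ (euclideanCol V i) x = (Vᵀ *ᵥ x.ofLp) i := by
  rw [EuclideanSpace.inner_eq_star_dotProduct, dotProduct_comm]
  simp [euclideanCol, Matrix.mulVec]
  rfl

omit [DecidableEq n] in
theorem orthonormal_euclideanCol {V : Matrix n (Fin k) ℝ} (hV : Vᵀ * V = 1) :
    Orthonormal ℝ (euclideanCol V) := by
  rw [orthonormal_iff_ite]
  intro i j
  rw [inner_euclideanCol]
  have := congrFun (congrFun hV i) j
  rw [Matrix.one_apply] at this
  rw [← this]
  rfl

theorem IsTopRightSingularVectors.isTopSingularFamily [DecidableEq m] {A : Matrix m n ℝ}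
    {V : Matrix n (Fin k) ℝ} (h : IsTopRightSingularVectors A V) :
    IsTopSingularFamily (Matrix.toEuclideanLin A) (euclideanCol V) := by
  refine ⟨orthonormal_euclideanCol h.orthonormal, fun i => ?_⟩
  rw [← Matrix.toEuclideanLin_conjTranspose_eq_adjoint]
  have := h.eigen i
  rw [← Matrix.mulVec_mulVec] at this
  exact congrArg (WithLp.toLp 2) this

omit [DecidableEq n] in
theorem starProjection_span_euclideanCol {V : Matrix n (Fin k) ℝ} (hV : Vᵀ * V = 1)
    (x : EuclideanSpace ℝ n) :
    (span ℝ (Set.range (euclideanCol V))).starProjection x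
      = WithLp.toLp 2 ((V * Vᵀ) *ᵥ x.ofLp) := by
  rw [starProjection_span_range (orthonormal_euclideanCol hV)]
  ext a
  rw [← Matrix.mulVec_mulVec]
  simp only [inner_euclideanCol]
  simp [euclideanCol, Matrix.mulVec, dotProduct, mul_comm]

theorem frobSq_eq_sum_col {m : Type*} [Fintype m] (A : Matrix m (Fin l) ℝ) :
    frobSq A = ∑ j, ‖euclideanCol A j‖ ^ 2 := by
  rw [frobSq, Finset.sum_comm]
  refine Finset.sum_congr rfl fun j _ => ?_
  rw [EuclideanSpace.norm_sq_eq]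
  simp [euclideanCol]

theorem subspaceStat_eq {V : Matrix n (Fin k) ℝ} (hV : Vᵀ * V = 1) (W : Matrix n (Fin l) ℝ) :
    subspaceStat V W = ∑ j, ‖euclideanCol W j
      - (span ℝ (Set.range (euclideanCol V))).starProjection (euclideanCol W j)‖ ^ 2 := by
  rw [subspaceStat, frobSq_eq_sum_col]
  refine Finset.sum_congr rfl fun j _ => ?_
  congr 2
  rw [starProjection_span_euclideanCol hV, Matrix.sub_mul, Matrix.one_mul]
  rfl

theorem frobSq_add_subspaceStat {V : Matrix n (Fin k) ℝ} (hV : Vᵀ * V = 1)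
    {W : Matrix n (Fin l) ℝ} (hW : Wᵀ * W = 1) :
    frobSq (V * Vᵀ * W) + subspaceStat V W = l := by
  rw [subspaceStat_eq hV, frobSq_eq_sum_col, ← Finset.sum_add_distrib]
  have : ∀ j, ‖euclideanCol (V * Vᵀ * W) j‖ ^ 2 + ‖euclideanCol W j
      - (span ℝ (Set.range (euclideanCol V))).starProjection (euclideanCol W j)‖ ^ 2 = 1 := by
    intro j
    rw [norm_sub_starProjection_sq, (orthonormal_euclideanCol hW).1 j,
      starProjection_span_euclideanCol hV]
    have : euclideanCol (V * Vᵀ * W) j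
      = WithLp.toLp 2 ((V * Vᵀ) *ᵥ (euclideanCol W j).ofLp) := rfl
    rw [this]
    ring
  simp [this]

omit [Fintype n] [DecidableEq n] in
theorem span_euclideanCol_le {V : Matrix n (Fin k) ℝ} {W : Matrix n (Fin l) ℝ}
    (h : colSpan W ≤ colSpan V) :
    span ℝ (Set.range (euclideanCol W)) ≤ span ℝ (Set.range (euclideanCol V)) := by
  have key : ∀ {p : ℕ} (A : Matrix n (Fin p) ℝ), span ℝ (Set.range (euclideanCol A))
      = (colSpan A).map (WithLp.linearEquiv 2 ℝ (n → ℝ)).symm.toLinearMap := by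
    intro p A
    rw [colSpan, Submodule.map_span, ← Set.range_comp]
    rfl
  rw [key, key]
  exact Submodule.map_mono h

theorem subspaceStat_eq_zero_of_colSpan_le {V : Matrix n (Fin k) ℝ} (hV : Vᵀ * V = 1)
    {W : Matrix n (Fin l) ℝ} (h : colSpan W ≤ colSpan V) : subspaceStat V W = 0 := by
  rw [subspaceStat_eq hV]
  refine Finset.sum_eq_zero fun j _ => ?_
  rw [starProjection_eq_self_iff.2 (span_euclideanCol_le h (subset_span (Set.mem_range_self j)))]
  simp

theorem finrank_range_toEuclideanLin [DecidableEq m] (A : Matrix m n ℝ) :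
    finrank ℝ (Matrix.toEuclideanLin A).range = A.rank := by
  rw [A.rank_eq_finrank_range_toLin (EuclideanSpace.basisFun m ℝ).toBasis
    (EuclideanSpace.basisFun n ℝ).toBasis, Matrix.toEuclideanLin_eq_toLin_orthonormal]

end MatrixBridge

/-! ### Deterministic bounds for the statistic -/

section Deterministic

open Module Submodule

variable {m₀ m₁ n : Type*} [Fintype m₀] [Fintype m₁] [DecidableEq m₀] [DecidableEq m₁]
  [Fintype n] [DecidableEq n] {M₀ Y₀ : Matrix m₀ n ℝ} {M₁ Y₁ : Matrix m₁ n ℝ}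
  {V V' : Matrix n (Fin M₀.rank) ℝ} {W W' : Matrix n (Fin M₁.rank) ℝ} {e₀ e₁ : ℝ}

/-- The operator norm of `A` is at most `e`. -/
def OpNormLE {m n : Type*} [Fintype m] [Fintype n] [DecidableEq n] (A : Matrix m n ℝ) (e : ℝ) :
    Prop :=
  ∀ x : EuclideanSpace ℝ n, ‖Matrix.toEuclideanLin A x‖ ≤ e * ‖x‖

theorem subspaceStat_le_of_colSpan_le (hV : IsTopRightSingularVectors M₀ V)
    (hV' : IsTopRightSingularVectors Y₀ V') (hW : IsTopRightSingularVectors M₁ W)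
    (hW' : IsTopRightSingularVectors Y₁ W') (he₀ : 0 ≤ e₀) (he₁ : 0 ≤ e₁)
    (h₀ : OpNormLE (Y₀ - M₀) e₀) (h₁ : OpNormLE (Y₁ - M₁) e₁) (hWV : colSpan W ≤ colSpan V) :
    subspaceStat V' W' ≤ 2 * M₁.rank * ((2 * e₀ / singularValue M₀ M₀.rank) ^ 2
      + (2 * e₁ / singularValue M₁ M₁.rank) ^ 2) := by
  simp only [OpNormLE, map_sub, LinearMap.sub_apply] at h₀ h₁
  rw [subspaceStat_eq hV'.orthonormal]
  refine sum_norm_sub_starProjection_sq_le_of_le (orthonormal_euclideanCol hW'.orthonormal) ?_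
    (fun j => subset_span (Set.mem_range_self j)) (span_euclideanCol_le hWV)
    (fun x hx => hV.isTopSingularFamily.norm_sub_starProjection_le hV'.isTopSingularFamily
      (finrank_range_toEuclideanLin _) he₀ h₀ hx)
    (fun x hx => hW.isTopSingularFamily.norm_sub_starProjection_le' hW'.isTopSingularFamily
      (finrank_range_toEuclideanLin _) he₁ h₁ hx)
  exact div_nonneg (by positivity) (LinearMap.singularValues_nonneg _ _)

theorem subspaceStat_le_add (hV : IsTopRightSingularVectors M₀ V)
    (hV' : IsTopRightSingularVectors Y₀ V') (hW : IsTopRightSingularVectors M₁ W)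
    (hW' : IsTopRightSingularVectors Y₁ W') (he₀ : 0 ≤ e₀) (he₁ : 0 ≤ e₁)
    (h₀ : OpNormLE (Y₀ - M₀) e₀) (h₁ : OpNormLE (Y₁ - M₁) e₁) :
    subspaceStat V W ≤ subspaceStat V' W' + 3 * M₁.rank * (2 * e₀ / singularValue M₀ M₀.rank
      + 2 * e₁ / singularValue M₁ M₁.rank) := by
  simp only [OpNormLE, map_sub, LinearMap.sub_apply] at h₀ h₁
  rw [subspaceStat_eq hV'.orthonormal, subspaceStat_eq hV.orthonormal]
  refine sum_norm_sub_starProjection_sq_le_add (orthonormal_euclideanCol hW.orthonormal)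
    (orthonormal_euclideanCol hW'.orthonormal) ?_
    (fun x hx => hV.isTopSingularFamily.norm_sub_starProjection_le' hV'.isTopSingularFamily
      (finrank_range_toEuclideanLin _) he₀ h₀ hx)
    (fun x hx => hW.isTopSingularFamily.norm_sub_starProjection_le hW'.isTopSingularFamily
      (finrank_range_toEuclideanLin _) he₁ h₁ hx)
  exact div_nonneg (by positivity) (LinearMap.singularValues_nonneg _ _)

end Deterministic

/-! ### From the Orlicz norm to the moment generating function -/

section SubGaussian

variable {Ω : Type*} [MeasurableSpace Ω] {μ : Measure Ω} {X : Ω → ℝ}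

/-- The linear term integrates to zero for a centred variable, leaving only the square exponential.
-/
theorem exp_le_add_exp_sq (x : ℝ) : Real.exp x ≤ x + Real.exp (x ^ 2) := by
  have h1 := Real.add_one_le_exp (x ^ 2)
  rcases le_or_gt |x| 1 with h | h
  · have := (abs_le.1 (Real.abs_exp_sub_one_sub_id_le h)).2
    linarith
  · rcases lt_abs.1 h with h | h
    · have : Real.exp x ≤ Real.exp (x ^ 2) := Real.exp_le_exp.2 (by nlinarith)
      linarith
    · have : Real.exp x ≤ 1 := Real.exp_le_one_iff.2 (by linarith)
      nlinarith

theorem integral_exp_sq_le [IsProbabilityMeasure μ] (hX : Measurable X) {t : ℝ}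
    (h : ∫⁻ ω, ENNReal.ofReal (Real.exp (X ω ^ 2 / t ^ 2)) ∂μ ≤ 2) :
    Integrable (fun ω => Real.exp (X ω ^ 2 / t ^ 2)) μ ∧
      ∫ ω, Real.exp (X ω ^ 2 / t ^ 2) ∂μ ≤ 2 := by
  have hm : Measurable fun ω => Real.exp (X ω ^ 2 / t ^ 2) := by fun_prop
  have hpos : ∀ᵐ ω ∂μ, 0 ≤ Real.exp (X ω ^ 2 / t ^ 2) := ae_of_all _ fun _ => (Real.exp_pos _).le
  have hi : Integrable (fun ω => Real.exp (X ω ^ 2 / t ^ 2)) μ := by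
    refine ⟨hm.aestronglyMeasurable, ?_⟩
    rw [hasFiniteIntegral_iff_ofReal hpos]
    exact h.trans_lt (by simp)
  refine ⟨hi, ?_⟩
  rw [integral_eq_lintegral_of_nonneg_ae hpos hm.aestronglyMeasurable]
  exact ENNReal.toReal_le_of_le_ofReal (by norm_num) (by simpa using h)

/-- A centred random variable with `𝔼 exp (X² / t²) ≤ 2` is sub-Gaussian. -/
theorem integrable_exp_mul_and_mgf_le [IsProbabilityMeasure μ] (hX : Measurable X)
    (hint : Integrable X μ) (hmean : ∫ ω, X ω ∂μ = 0) {t : ℝ} (ht : 0 < t)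
    (h : ∫⁻ ω, ENNReal.ofReal (Real.exp (X ω ^ 2 / t ^ 2)) ∂μ ≤ 2) (a : ℝ) :
    Integrable (fun ω => Real.exp (a * X ω)) μ ∧ mgf X μ a ≤ Real.exp (t ^ 2 * a ^ 2) := by
  obtain ⟨hi, hle⟩ := integral_exp_sq_le hX h
  set Z : Ω → ℝ := fun ω => Real.exp (X ω ^ 2 / t ^ 2) with hZ
  set b := t * a with hb
  have hab : ∀ ω, a * X ω = b * (X ω / t) := fun ω => by rw [hb]; field_simp
  have hY : ∀ ω, (X ω / t) ^ 2 = X ω ^ 2 / t ^ 2 := fun ω => div_pow _ _ _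
  have hexp : ∀ c ω, 0 ≤ c → c ≤ 1 → Real.exp (c * (X ω / t) ^ 2) ≤ c * Z ω + (1 - c) := by
    intro c ω h0 h1
    have := convexOn_exp.2 (Set.mem_univ ((X ω / t) ^ 2)) (Set.mem_univ 0) h0
      (sub_nonneg.2 h1) (add_sub_cancel _ _)
    simpa [hZ, hY] using this
  suffices ∃ G : Ω → ℝ, Integrable G μ ∧ (∀ ω, Real.exp (a * X ω) ≤ G ω) ∧
      ∫ ω, G ω ∂μ ≤ Real.exp (t ^ 2 * a ^ 2) by
    obtain ⟨G, hG, hXG, hGle⟩ := this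
    have hiX : Integrable (fun ω => Real.exp (a * X ω)) μ := by
      refine hG.mono' (by fun_prop) (ae_of_all _ fun ω => ?_)
      rw [Real.norm_eq_abs, Real.abs_exp]
      exact hXG ω
    exact ⟨hiX, (integral_mono hiX hG hXG).trans hGle⟩
  have hb2 : t ^ 2 * a ^ 2 = b ^ 2 := by rw [hb]; ring
  rw [hb2]
  -- For small `b`, `exp_le_add_exp_sq` and convexity suffice. For large `b`, use bx ≤ b²/2 + x²/2;
  -- the resulting factor 3/2 is at most exp(b²/2).
  rcases le_or_gt (b ^ 2) 1 with h1 | h1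
  · have hi1 : Integrable (fun ω => b ^ 2 * Z ω + (1 - b ^ 2)) μ :=
      (hi.const_mul _).add (integrable_const _)
    refine ⟨fun ω => a * X ω + (b ^ 2 * Z ω + (1 - b ^ 2)), (hint.const_mul a).add hi1,
      fun ω => ?_, ?_⟩
    · refine (exp_le_add_exp_sq _).trans (add_le_add_right ?_ _)
      rw [hab, mul_pow]
      exact hexp _ ω (sq_nonneg _) h1
    · rw [integral_add (hint.const_mul a) hi1,
        integral_add (hi.const_mul _) (integrable_const _), integral_const_mul,
        integral_const_mul, hmean]
      simp only [integral_const, probReal_univ, smul_eq_mul, mul_zero, one_mul, zero_add]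
      have := Real.add_one_le_exp (b ^ 2)
      nlinarith [sq_nonneg b]
  · refine ⟨fun ω => Real.exp (b ^ 2 / 2) * (1 / 2 * Z ω + (1 - 1 / 2)),
      ((hi.const_mul _).add (integrable_const _)).const_mul _, fun ω => ?_, ?_⟩
    · calc Real.exp (a * X ω) ≤ Real.exp (b ^ 2 / 2 + 1 / 2 * (X ω / t) ^ 2) := by
            rw [Real.exp_le_exp, hab]
            nlinarith [sq_nonneg (b - X ω / t)]
        _ ≤ _ := by
            rw [Real.exp_add]
            refine mul_le_mul_of_nonneg_left ?_ (Real.exp_pos _).le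
            exact hexp _ ω (by norm_num) (by norm_num)
    · rw [integral_const_mul, integral_add (hi.const_mul _) (integrable_const _),
        integral_const_mul]
      simp only [integral_const, probReal_univ, smul_eq_mul, one_mul]
      have h2 := Real.add_one_le_exp (b ^ 2 / 2)
      have h3 : Real.exp (b ^ 2) = Real.exp (b ^ 2 / 2) * Real.exp (b ^ 2 / 2) := by
        rw [← Real.exp_add]; ring_nf
      rw [h3]
      gcongr
      linarith

theorem lintegral_exp_sq_le_two_of_psiTwoNorm_lt {s t : ℝ} (hs : 0 ≤ s) (hst : s < t)
    (h : psiTwoNorm X μ ≤ ENNReal.ofReal s) :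
    ∫⁻ ω, ENNReal.ofReal (Real.exp (X ω ^ 2 / t ^ 2)) ∂μ ≤ 2 := by
  have h1 : psiTwoNorm X μ < ENNReal.ofReal t :=
    h.trans_lt ((ENNReal.ofReal_lt_ofReal_iff (hs.trans_lt hst)).2 hst)
  simp only [psiTwoNorm, iInf_lt_iff] at h1
  obtain ⟨u, hu, hle, hut⟩ := h1
  refine (lintegral_mono fun ω => ENNReal.ofReal_le_ofReal (Real.exp_le_exp.2 ?_)).trans hle
  have : u < t := (ENNReal.ofReal_lt_ofReal_iff (hs.trans_lt hst)).1 hut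
  gcongr

theorem hasSubgaussianMGF_of_psiTwoNorm_le [IsProbabilityMeasure μ] (hX : Measurable X)
    (hint : Integrable X μ) (hmean : ∫ ω, X ω ∂μ = 0) {s : ℝ} (hs : 0 ≤ s)
    (h : psiTwoNorm X μ ≤ ENNReal.ofReal s) :
    HasSubgaussianMGF X (2 * (s ^ 2).toNNReal) μ := by
  have key : ∀ t, s < t → ∀ a, Integrable (fun ω => Real.exp (a * X ω)) μ ∧
      mgf X μ a ≤ Real.exp (t ^ 2 * a ^ 2) := fun t hst a =>
    integrable_exp_mul_and_mgf_le hX hint hmean (hs.trans_lt hst)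
      (lintegral_exp_sq_le_two_of_psiTwoNorm_lt hs hst h) a
  refine ⟨fun a => (key (s + 1) (by linarith) a).1, fun a => ?_⟩
  -- The norm is an infimum, so the bound is available for every `t > s` and passes to the limit `t
  -- ↓ s`.
  have hc : ContinuousWithinAt (fun t : ℝ => Real.exp (t ^ 2 * a ^ 2)) (Set.Ioi s) s :=
    (by fun_prop : Continuous fun t : ℝ => Real.exp (t ^ 2 * a ^ 2)).continuousWithinAt
  have := ge_of_tendsto hc (Filter.eventually_of_mem self_mem_nhdsWithin fun t ht => (key t ht a).2)
  refine this.trans_eq ?_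
  push_cast
  rw [Real.coe_toNNReal _ (sq_nonneg _)]
  ring_nf

end SubGaussian

/-! ### Nets on spheres -/

section Net

open Module

/-- The unit sphere of an `n`-dimensional space has a `1/2`-net with at most `5 ^ n` points. -/
theorem exists_finset_net (E : Type*) [NormedAddCommGroup E] [NormedSpace ℝ E]
    [FiniteDimensional ℝ E] :
    ∃ s : Finset E, s.card ≤ 5 ^ finrank ℝ E ∧ (∀ x ∈ s, ‖x‖ = 1) ∧
      ∀ x : E, ‖x‖ = 1 → ∃ y ∈ s, ‖x - y‖ ≤ 1 / 2 := by
  classical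
  let p : ℕ → Prop := fun m => ∃ s : Finset E, s.card = m ∧ (∀ x ∈ s, ‖x‖ = 1) ∧
    ∀ x ∈ s, ∀ y ∈ s, x ≠ y → 1 / 2 < ‖x - y‖
  have hbound : ∀ m, p m → m ≤ 5 ^ finrank ℝ E := by
    rintro m ⟨s, rfl, hs1, hs⟩
    -- Doubling turns unit vectors at distance above 1/2 into vectors of norm 2 at distance above 1,
    -- as the packing bound requires.
    have hinj : Function.Injective fun x : E => (2 : ℝ) • x := smul_right_injective E two_ne_zero
    rw [← Finset.card_image_of_injective s hinj]
    refine Besicovitch.card_le_of_separated _ ?_ ?_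
    · intro c hc
      obtain ⟨x, hx, rfl⟩ := Finset.mem_image.1 hc
      simp [norm_smul, hs1 x hx]
    · intro c hc d hd hcd
      obtain ⟨x, hx, rfl⟩ := Finset.mem_image.1 hc
      obtain ⟨y, hy, rfl⟩ := Finset.mem_image.1 hd
      have := hs x hx y hy fun h => hcd (by rw [h])
      rw [← smul_sub, norm_smul, Real.norm_two]
      linarith
  have h0 : p 0 := ⟨∅, by simp⟩
  have hP := Nat.findGreatest_spec (P := p) (Nat.zero_le (5 ^ finrank ℝ E)) h0
  obtain ⟨s, hcard, hs1, hs⟩ := hP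
  refine ⟨s, hcard.trans_le (Nat.findGreatest_le _), hs1, fun x hx => ?_⟩
  by_contra! hfar
  have hxs : x ∉ s := fun hxs => by
    have := hfar x hxs
    norm_num at this
  have hp : p (s.card + 1) := by
    refine ⟨insert x s, Finset.card_insert_of_notMem hxs, ?_, ?_⟩
    · simpa [hx] using hs1
    · intro a ha b hb hab
      rcases Finset.mem_insert.1 ha with ha' | ha' <;>
        rcases Finset.mem_insert.1 hb with hb' | hb'
      · exact absurd (ha'.trans hb'.symm) hab
      · rw [ha']; exact hfar b hb'
      · rw [hb', norm_sub_rev]; exact hfar a ha'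
      · exact hs a ha' b hb' hab
  have := Nat.le_findGreatest (hbound _ hp) hp
  omega

theorem norm_map_le_of_net {E F : Type*} [NormedAddCommGroup E] [NormedSpace ℝ E]
    [FiniteDimensional ℝ E] [NormedAddCommGroup F] [NormedSpace ℝ F] (A : E →ₗ[ℝ] F) {s : Finset E}
    (hs : ∀ x : E, ‖x‖ = 1 → ∃ y ∈ s, ‖x - y‖ ≤ 1 / 2) {c : ℝ} (hc : 0 ≤ c)
    (h : ∀ y ∈ s, ‖A y‖ ≤ c) (x : E) : ‖A x‖ ≤ 2 * c * ‖x‖ := by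
  let B := A.toContinuousLinearMap
  have key : ‖B‖ ≤ c + ‖B‖ / 2 := by
    refine B.opNorm_le_of_unit_norm (by positivity) fun x hx => ?_
    obtain ⟨y, hy, hxy⟩ := hs x hx
    calc ‖B x‖ = ‖A y + B (x - y)‖ := by rw [map_sub]; simp [B]
      _ ≤ ‖A y‖ + ‖B (x - y)‖ := norm_add_le _ _
      _ ≤ c + ‖B‖ * (1 / 2) := by
          gcongr
          · exact h y hy
          · exact (B.le_opNorm _).trans (by gcongr)
      _ = _ := by ring
  exact (B.le_opNorm x).trans (by gcongr; linarith)

theorem norm_map_le_of_inner_net {E F : Type*} [NormedAddCommGroup E] [NormedSpace ℝ E]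
    [FiniteDimensional ℝ E] [NormedAddCommGroup F] [InnerProductSpace ℝ F] (A : E →ₗ[ℝ] F)
    {s : Finset E} {t : Finset F} (hs : ∀ x : E, ‖x‖ = 1 → ∃ y ∈ s, ‖x - y‖ ≤ 1 / 2)
    (ht : ∀ x : F, ‖x‖ = 1 → ∃ y ∈ t, ‖x - y‖ ≤ 1 / 2) {c : ℝ} (hc : 0 ≤ c)
    (h : ∀ x ∈ s, ∀ y ∈ t, inner ℝ y (A x) ≤ c) (x : E) : ‖A x‖ ≤ 4 * c * ‖x‖ := by
  have key : ∀ x ∈ s, ‖A x‖ ≤ 2 * c := by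
    intro x hx
    set z := A x
    rcases eq_or_ne z 0 with h0 | h0
    · rw [h0, norm_zero]; positivity
    have hz : ‖z‖ ≠ 0 := norm_ne_zero_iff.2 h0
    obtain ⟨y, hy, hxy⟩ := ht (‖z‖⁻¹ • z) (by rw [norm_smul, norm_inv, norm_norm]; field_simp)
    have h1 : inner ℝ (‖z‖⁻¹ • z) z = ‖z‖ := by
      rw [inner_smul_left, real_inner_self_eq_norm_sq]
      simp
      field_simp
    have h2 : inner ℝ (‖z‖⁻¹ • z - y) z ≤ 1 / 2 * ‖z‖ :=
      (real_inner_le_norm _ _).trans (by gcongr)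
    rw [inner_sub_left, h1] at h2
    linarith [h x hx y hy]
  refine (norm_map_le_of_net A hs (by positivity) key x).trans_eq ?_
  ring

end Net

/-! ### Operator norm of a random matrix -/

section OperatorNorm

variable {Ω : Type*} [MeasurableSpace Ω] {μ : Measure Ω} [IsProbabilityMeasure μ]
  {m n : Type*} [Fintype m] [Fintype n] [DecidableEq n] {ε : m → n → Ω → ℝ}

theorem inner_toEuclideanLin_of (a : m → n → ℝ) (y : EuclideanSpace ℝ m)
    (x : EuclideanSpace ℝ n) :
    inner ℝ y (Matrix.toEuclideanLin (Matrix.of a) x)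
      = ∑ p : m × n, y p.1 * x p.2 * a p.1 p.2 := by
  rw [EuclideanSpace.inner_eq_star_dotProduct, Fintype.sum_prod_type, dotProduct]
  refine Finset.sum_congr rfl fun i _ => ?_
  simp only [Matrix.ofLp_toLpLin, Matrix.toLin'_apply, Matrix.mulVec, dotProduct, Matrix.of_apply,
    Finset.sum_mul]
  refine Finset.sum_congr rfl fun j _ => ?_
  simp
  ring

omit [IsProbabilityMeasure μ] in
theorem measure_inner_ge_le {c : NNReal}
    (hind : iIndepFun (fun p : m × n => ε p.1 p.2) μ)
    (hsub : ∀ i j, HasSubgaussianMGF (ε i j) c μ) {y : EuclideanSpace ℝ m}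
    {x : EuclideanSpace ℝ n} (hy : ‖y‖ = 1) (hx : ‖x‖ = 1) {u : ℝ} (hu : 0 ≤ u) :
    μ.real {ω | u ≤ inner ℝ y (Matrix.toEuclideanLin (Matrix.of fun i j => ε i j ω) x)}
      ≤ Real.exp (-u ^ 2 / (2 * c)) := by
  have h1 : iIndepFun (fun (p : m × n) ω => y p.1 * x p.2 * ε p.1 p.2 ω) μ :=
    hind.comp (fun p z => y p.1 * x p.2 * z) fun p => by fun_prop
  have h2 := HasSubgaussianMGF.sum_of_iIndepFun h1 (s := Finset.univ)
    (fun p _ => (hsub p.1 p.2).const_mul (y p.1 * x p.2))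
  have h3 := h2.measure_ge_le hu
  have hc : ((∑ p : m × n, NNReal.mk ((y p.1 * x p.2) ^ 2) (sq_nonneg _) * c : NNReal) : ℝ) = c := by
    push_cast
    rw [← Finset.sum_mul, Fintype.sum_prod_type]
    have : ∑ i, ∑ j, (y i * x j) ^ 2 = 1 := by
      simp only [mul_pow, ← Finset.mul_sum, ← Finset.sum_mul]
      have hy2 := EuclideanSpace.real_norm_sq_eq y
      have hx2 := EuclideanSpace.real_norm_sq_eq x
      rw [← hy2, ← hx2, hy, hx]
      norm_num
    refine (congrArg (· * (c : ℝ)) this).trans (one_mul _)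
  replace h3 := h3.trans_eq (congrArg (fun z : ℝ => Real.exp (-u ^ 2 / (2 * z))) hc)
  simpa only [inner_toEuclideanLin_of] using h3

/-- Concentration of the operator norm of a matrix with independent sub-Gaussian entries. -/
theorem measure_not_opNormLE_le {s : ℝ} (hs : 0 ≤ s)
    (hind : iIndepFun (fun p : m × n => ε p.1 p.2) μ)
    (hsub : ∀ i j, HasSubgaussianMGF (ε i j) (2 * (s ^ 2).toNNReal) μ) {a : ℝ} (ha : 0 < a)
    (ha1 : a ≤ 1) :
    μ {ω | ¬ OpNormLE (Matrix.of fun i j => ε i j ω)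
      (12 * s * phi (Fintype.card m) (Fintype.card n) a)} ≤ ENNReal.ofReal a := by
  -- With zero parameter the tail bound carries no information; the entries vanish almost surely
  -- instead.
  rcases hs.eq_or_lt with rfl | hs
  · have h0 : ∀ᵐ ω ∂μ, ∀ i j, ε i j ω = 0 := by
      rw [ae_all_iff]; intro i
      rw [ae_all_iff]; intro j
      exact HasSubgaussianMGF.ae_eq_zero_of_hasSubgaussianMGF_zero (by simpa using hsub i j)
    refine le_of_eq_of_le (measure_mono_null ?_ (ae_iff.1 h0)) zero_le
    intro ω hω h
    refine hω fun x => ?_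
    have : (Matrix.of fun i j => ε i j ω) = 0 := by ext i j; exact h i j
    simp [this]
  set φ := phi (Fintype.card m) (Fintype.card n) a with hφ
  have hL : 0 ≤ Real.log (1 / a) := Real.log_nonneg (by rw [le_div_iff₀ ha]; linarith)
  have hφ0 : 0 ≤ φ := by rw [hφ, phi]; positivity
  have hφ2 : (Fintype.card m : ℝ) + Fintype.card n + Real.log (1 / a) ≤ φ ^ 2 := by
    have h1 := Real.sq_sqrt (Nat.cast_nonneg (α := ℝ) (Fintype.card m))
    have h2 := Real.sq_sqrt (Nat.cast_nonneg (α := ℝ) (Fintype.card n))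
    have h3 := Real.sq_sqrt hL
    rw [hφ, phi]
    have p1 := Real.sqrt_nonneg (Fintype.card m : ℝ)
    have p2 := Real.sqrt_nonneg (Fintype.card n : ℝ)
    have p3 := Real.sqrt_nonneg (Real.log (1 / a))
    nlinarith [mul_nonneg p1 p2, mul_nonneg p1 p3, mul_nonneg p2 p3]
  obtain ⟨A, hAc, hA1, hA⟩ := exists_finset_net (EuclideanSpace ℝ n)
  obtain ⟨B, hBc, hB1, hB⟩ := exists_finset_net (EuclideanSpace ℝ m)
  rw [finrank_euclideanSpace] at hAc hBc
  -- The nets cost a factor 4, whence 12 = 4 · 3. The tail exponent is 9φ²/4 ≥ 2φ², which beats the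
  -- at most 5^(m+n) ≤ exp(2(m+n)) pairs of net points and leaves at most `a`.
  set u := 3 * s * φ with hu
  have hu0 : 0 ≤ u := by positivity
  let bad : EuclideanSpace ℝ n × EuclideanSpace ℝ m → Set Ω := fun q =>
    {ω | u ≤ inner ℝ q.2 (Matrix.toEuclideanLin (Matrix.of fun i j => ε i j ω) q.1)}
  have hsubset : {ω | ¬ OpNormLE (Matrix.of fun i j => ε i j ω) (12 * s * φ)}
      ⊆ ⋃ q ∈ A ×ˢ B, bad q := by
    intro ω hω
    by_contra hnot
    refine hω fun x => ?_
    have := norm_map_le_of_inner_net (Matrix.toEuclideanLin (Matrix.of fun i j => ε i j ω)) hA hB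
      hu0 (fun x hx y hy => ?_) x
    · refine this.trans_eq ?_
      rw [hu]; ring
    · by_contra! hlt
      exact hnot (Set.mem_biUnion (x := (x, y)) (Finset.mem_product.2 ⟨hx, hy⟩) hlt.le)
  have hq : ∀ q ∈ A ×ˢ B, μ (bad q) ≤ ENNReal.ofReal (Real.exp (-2 * φ ^ 2)) := by
    intro q hq
    rw [Finset.mem_product] at hq
    rw [← ENNReal.ofReal_toReal (measure_ne_top μ (bad q))]
    refine ENNReal.ofReal_le_ofReal
      ((measure_inner_ge_le hind hsub (hB1 _ hq.2) (hA1 _ hq.1) hu0).trans ?_)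
    rw [Real.exp_le_exp]
    push_cast
    rw [Real.coe_toNNReal _ (sq_nonneg _), hu]
    have : -(3 * s * φ) ^ 2 / (2 * (2 * s ^ 2)) = -(9 / 4) * φ ^ 2 := by field_simp; ring
    rw [this]
    nlinarith [sq_nonneg φ]
  have h5 : (5 : ℝ) ≤ Real.exp 2 := by
    have := Real.exp_one_gt_d9
    have h2 : Real.exp 2 = Real.exp 1 * Real.exp 1 := by rw [← Real.exp_add]; norm_num
    rw [h2]; nlinarith
  calc μ _ ≤ μ (⋃ q ∈ A ×ˢ B, bad q) := measure_mono hsubset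
    _ ≤ ∑ q ∈ A ×ˢ B, μ (bad q) := measure_biUnion_finset_le _ _
    _ ≤ ∑ q ∈ A ×ˢ B, ENNReal.ofReal (Real.exp (-2 * φ ^ 2)) := Finset.sum_le_sum hq
    _ = ENNReal.ofReal ((A.card * B.card : ℕ) * Real.exp (-2 * φ ^ 2)) := by
        rw [Finset.sum_const, Finset.card_product, nsmul_eq_mul,
          ENNReal.ofReal_mul (Nat.cast_nonneg _), ENNReal.ofReal_natCast]
    _ ≤ ENNReal.ofReal a := by
        refine ENNReal.ofReal_le_ofReal ?_
        have h6 : ((A.card * B.card : ℕ) : ℝ)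
            ≤ Real.exp (2 * (Fintype.card m + Fintype.card n)) := by
          calc ((A.card * B.card : ℕ) : ℝ) ≤ ((5 ^ Fintype.card n * 5 ^ Fintype.card m : ℕ) : ℝ) := by
                exact_mod_cast Nat.mul_le_mul hAc hBc
            _ = 5 ^ (Fintype.card m + Fintype.card n) := by push_cast; ring
            _ ≤ Real.exp 2 ^ (Fintype.card m + Fintype.card n) := by gcongr
            _ = _ := by rw [← Real.exp_nat_mul]; push_cast; ring_nf
        calc _ ≤ Real.exp (2 * (Fintype.card m + Fintype.card n)) * Real.exp (-2 * φ ^ 2) := by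
              gcongr
          _ ≤ Real.exp (-Real.log (1 / a)) := by
              rw [← Real.exp_add, Real.exp_le_exp]
              linarith
          _ = a := by rw [one_div, Real.log_inv, neg_neg, Real.exp_log ha]

end OperatorNorm

/-! ### Conditional laws given a random variable -/

section ConditionalLaw

variable {Ω β : Type*} [MeasurableSpace Ω] [StandardBorelSpace Ω] [MeasurableSpace β]
  (P : Measure Ω) [IsFiniteMeasure P] {f : Ω → β}

theorem condExpKernel_comap_congr {ω ω' : Ω} (h : f ω' = f ω) :
    condExpKernel P (MeasurableSpace.comap f inferInstance) ω'
      = condExpKernel P (MeasurableSpace.comap f inferInstance) ω := by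
  refine Measure.ext fun s hs => ?_
  obtain ⟨g, -, hg⟩ := (measurable_condExpKernel (μ := P)
    (m := MeasurableSpace.comap f inferInstance) hs).exists_eq_measurable_comp
  have := fun x => congrFun hg x
  simp only [Function.comp_apply] at this
  rw [this, this, h]

/-- Given `f`, the conditional law at `ω` is concentrated on the fibre of `f` through `ω`. -/
theorem condExpKernel_comap_ae_eq [MeasurableSpace.CountablySeparated β] (hf : Measurable f) :
    ∀ᵐ ω ∂P, ∀ᵐ ω' ∂(condExpKernel P (MeasurableSpace.comap f inferInstance) ω), f ω' = f ω := by
  have hm : MeasurableSpace.comap f inferInstance ≤ (inferInstance : MeasurableSpace Ω) :=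
    hf.comap_le
  -- Coding values by bit sequences leaves countably many events. Each lies in the conditioning
  -- σ-algebra, so its conditional probability is almost surely its indicator.
  obtain ⟨g, hg, hginj⟩ := MeasurableSpace.measurable_injection_nat_bool_of_countablySeparated β
  have key : ∀ i : ℕ, ∀ᵐ ω ∂P,
      ∀ᵐ ω' ∂(condExpKernel P (MeasurableSpace.comap f inferInstance) ω),
        g (f ω') i = g (f ω) i := by
    intro i
    have hb : ∀ b : Bool, ∀ᵐ ω ∂P,
        (condExpKernel P (MeasurableSpace.comap f inferInstance) ω).real {x | g (f x) i = b}
          = Set.indicator {x | g (f x) i = b} (fun _ => (1 : ℝ)) ω := by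
      intro b
      have hs : MeasurableSet {x : β | g x i = b} :=
        (measurable_pi_apply i).comp hg (MeasurableSet.singleton b)
      have hs' : MeasurableSet[MeasurableSpace.comap f inferInstance] {x : Ω | g (f x) i = b} :=
        ⟨_, hs, rfl⟩
      have h1 := condExpKernel_ae_eq_condExp (μ := P) hm (hm _ hs')
      have h2 : P[Set.indicator {x : Ω | g (f x) i = b} (fun _ => (1 : ℝ))|
          MeasurableSpace.comap f inferInstance] = Set.indicator {x | g (f x) i = b} fun _ => 1 :=
        condExp_of_stronglyMeasurable hm (stronglyMeasurable_const.indicator hs')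
          ((integrable_const _).indicator (hm _ hs'))
      filter_upwards [h1] with ω hω
      rw [hω]
      exact congrFun h2 ω
    filter_upwards [hb true, hb false] with ω h1 h2
    have hb' : (condExpKernel P (MeasurableSpace.comap f inferInstance) ω).real
        {x | g (f x) i = !(g (f ω) i)} = 0 := by
      cases hgi : g (f ω) i
      · simpa [hgi] using h1
      · simpa [hgi] using h2
    rw [measureReal_eq_zero_iff] at hb'
    rw [ae_iff]
    convert hb' using 2
    ext x
    simp only [Set.mem_ofPred_eq]
    cases g (f x) i <;> cases g (f ω) i <;> simp
  filter_upwards [ae_all_iff.2 key] with ω hω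
  filter_upwards [ae_all_iff.2 hω] with ω' h
  exact hginj (funext h)

end ConditionalLaw

namespace Panel

variable {Ω : Type*} [MeasurableSpace Ω] [StandardBorelSpace Ω] {N T₀ T₁ D r : ℕ}
  (S : Panel Ω N T₀ T₁ D r) (P : Measure Ω) [IsFiniteMeasure P]

omit [StandardBorelSpace Ω] in
theorem measurable_latent : Measurable S.latent :=
  (measurable_pi_lambda _ fun t => measurable_pi_lambda _ fun d => S.measurable_u t d).prodMk
    ((measurable_pi_lambda _ fun n => S.measurable_v n).prodMk
      (measurable_pi_lambda _ fun n => S.measurable_assign n))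

theorem condLaw_congr {ω ω' : Ω} (h : S.latent ω' = S.latent ω) :
    S.condLaw P ω' = S.condLaw P ω :=
  condExpKernel_comap_congr P h

theorem ae_condLaw_latent_eq : ∀ᵐ ω ∂P, ∀ᵐ ω' ∂(S.condLaw P ω), S.latent ω' = S.latent ω := by
  have h₁ : StandardBorelSpace (Fin r → ℝ) := inferInstance
  have h₂ : StandardBorelSpace (Fin D → Fin r → ℝ) := StandardBorelSpace.pi_countable
  have h₃ : StandardBorelSpace (Fin (T₀ + T₁) → Fin D → Fin r → ℝ) :=
    StandardBorelSpace.pi_countable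
  have h₄ : StandardBorelSpace (Fin N → Fin r → ℝ) := StandardBorelSpace.pi_countable
  have h₅ : StandardBorelSpace (Fin N → Fin D) := StandardBorelSpace.pi_countable
  exact condExpKernel_comap_ae_eq P S.measurable_latent

instance (ω : Ω) : IsProbabilityMeasure (S.condLaw P ω) := by
  unfold condLaw
  infer_instance

end Panel

/-! ### Comparison with the critical value -/

section CriticalValue

variable {T₀ T₁ : ℕ} {n : Type*} [Fintype n] [DecidableEq n]

/-- The critical value as a function of the two mean matrices. -/
noncomputable def matrixCriticalValue (M₀ : Matrix (Fin T₀) n ℝ) (M₁ : Matrix (Fin T₁) n ℝ)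
    (C σ α : ℝ) : ℝ :=
  C * σ ^ 2 * M₁.rank * phi T₀ (Fintype.card n) (α / 2) ^ 2 / singularValue M₀ M₀.rank ^ 2
  + C * σ ^ 2 * M₁.rank * phi T₁ (Fintype.card n) (α / 2) ^ 2 / singularValue M₁ M₁.rank ^ 2
  + C * σ * M₁.rank * phi T₀ (Fintype.card n) (α / 2) / singularValue M₀ M₀.rank

/-- The row space of `M₁` is contained in that of `M₀`. -/
def Aligned (M₀ : Matrix (Fin T₀) n ℝ) (M₁ : Matrix (Fin T₁) n ℝ) : Prop :=
  ∃ (V : Matrix n (Fin M₀.rank) ℝ) (W : Matrix n (Fin M₁.rank) ℝ),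
    IsTopRightSingularVectors M₀ V ∧ IsTopRightSingularVectors M₁ W ∧ colSpan W ≤ colSpan V

/-- The row space of `M₁` is far from that of `M₀`. -/
def Separated (M₀ : Matrix (Fin T₀) n ℝ) (M₁ : Matrix (Fin T₁) n ℝ) (C σ α : ℝ) : Prop :=
  ∃ (V : Matrix n (Fin M₀.rank) ℝ) (W : Matrix n (Fin M₁.rank) ℝ),
    IsTopRightSingularVectors M₀ V ∧ IsTopRightSingularVectors M₁ W ∧
    frobSq (V * Vᵀ * W) + 2 * matrixCriticalValue M₀ M₁ C σ α
      + C * σ * M₁.rank * phi T₁ (Fintype.card n) (α / 2) / singularValue M₁ M₁.rank < M₁.rank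

theorem phi_nonneg (T n : ℕ) (a : ℝ) : 0 ≤ phi T n a := by
  unfold phi
  positivity

theorem singularValue_nonneg {m : Type*} [Fintype m] (A : Matrix m n ℝ) (l : ℕ) :
    0 ≤ singularValue A l :=
  LinearMap.singularValues_nonneg _ _

variable {M₀ Y₀ : Matrix (Fin T₀) n ℝ} {M₁ Y₁ : Matrix (Fin T₁) n ℝ}
  {V' : Matrix n (Fin M₀.rank) ℝ} {W' : Matrix n (Fin M₁.rank) ℝ} {K C σ α : ℝ}

theorem matrixCriticalValue_nonneg (hC : 0 ≤ C) (hσ : 0 ≤ σ) :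
    0 ≤ matrixCriticalValue M₀ M₁ C σ α := by
  have h₀ := phi_nonneg T₀ (Fintype.card n) (α / 2)
  have h₁ := phi_nonneg T₁ (Fintype.card n) (α / 2)
  have h₂ := singularValue_nonneg M₀ M₀.rank
  unfold matrixCriticalValue
  positivity

theorem Aligned.subspaceStat_le (h : Aligned M₀ M₁) (hK : 0 < K) (hσ : 0 ≤ σ)
    (hC : 1152 * K ^ 2 ≤ C)
    (hV' : IsTopRightSingularVectors Y₀ V') (hW' : IsTopRightSingularVectors Y₁ W')
    (h₀ : OpNormLE (Y₀ - M₀) (12 * (K * σ) * phi T₀ (Fintype.card n) (α / 2)))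
    (h₁ : OpNormLE (Y₁ - M₁) (12 * (K * σ) * phi T₁ (Fintype.card n) (α / 2))) :
    subspaceStat V' W' ≤ matrixCriticalValue M₀ M₁ C σ α := by
  obtain ⟨V, W, hV, hW, hWV⟩ := h
  have p₀ := phi_nonneg T₀ (Fintype.card n) (α / 2)
  have p₁ := phi_nonneg T₁ (Fintype.card n) (α / 2)
  have q₀ := singularValue_nonneg M₀ M₀.rank
  refine (subspaceStat_le_of_colSpan_le hV hV' hW hW' (by positivity) (by positivity)
    h₀ h₁ hWV).trans ?_
  unfold matrixCriticalValue
  set φ₀ := phi T₀ (Fintype.card n) (α / 2)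
  set φ₁ := phi T₁ (Fintype.card n) (α / 2)
  set s₀ := singularValue M₀ M₀.rank
  set s₁ := singularValue M₁ M₁.rank
  set l : ℝ := (M₁.rank : ℝ) with hl
  have hl0 : 0 ≤ l := Nat.cast_nonneg _
  have hC0 : 0 ≤ C := le_trans (by positivity) hC
  -- Here 1152 = 2 · 24². Division by zero gives zero, so the rank-zero convention needs no separate
  -- case.
  have key : ∀ φ s : ℝ, 2 * l * (2 * (12 * (K * σ) * φ) / s) ^ 2
      ≤ C * σ ^ 2 * l * φ ^ 2 / s ^ 2 := by
    intro φ s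
    calc _ = 1152 * K ^ 2 * σ ^ 2 * l * φ ^ 2 / s ^ 2 := by rw [div_pow]; ring
      _ ≤ _ := by gcongr
  have h3 : 0 ≤ C * σ * l * φ₀ / s₀ := by positivity
  have := key φ₀ s₀
  have := key φ₁ s₁
  rw [mul_add]
  linarith

theorem Separated.matrixCriticalValue_lt (h : Separated M₀ M₁ C σ α) (hK : 0 < K) (hσ : 0 ≤ σ)
    (hC : 72 * K ≤ C)
    (hV' : IsTopRightSingularVectors Y₀ V') (hW' : IsTopRightSingularVectors Y₁ W')
    (h₀ : OpNormLE (Y₀ - M₀) (12 * (K * σ) * phi T₀ (Fintype.card n) (α / 2)))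
    (h₁ : OpNormLE (Y₁ - M₁) (12 * (K * σ) * phi T₁ (Fintype.card n) (α / 2))) :
    matrixCriticalValue M₀ M₁ C σ α < subspaceStat V' W' := by
  obtain ⟨V, W, hV, hW, hlt⟩ := h
  have p₀ := phi_nonneg T₀ (Fintype.card n) (α / 2)
  have p₁ := phi_nonneg T₁ (Fintype.card n) (α / 2)
  have q₀ := singularValue_nonneg M₀ M₀.rank
  have q₁ := singularValue_nonneg M₁ M₁.rank
  have h2 := subspaceStat_le_add hV hV' hW hW' (by positivity) (by positivity) h₀ h₁
  have h3 := frobSq_add_subspaceStat hV.orthonormal hW.orthonormal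
  have h4 : C * σ * M₁.rank * phi T₀ (Fintype.card n) (α / 2) / singularValue M₀ M₀.rank
      ≤ matrixCriticalValue M₀ M₁ C σ α := by
    have hC0 : 0 ≤ C := le_trans (by positivity) hC
    unfold matrixCriticalValue
    exact le_add_of_nonneg_left (by positivity)
  -- Here 72 = 3 · 24. The pre-intervention error is absorbed by one of the two copies of the
  -- critical value, leaving the other for the conclusion.
  have key : ∀ φ s : ℝ, 0 ≤ φ → 0 ≤ s → 3 * (M₁.rank : ℝ) * (2 * (12 * (K * σ) * φ) / s)
      ≤ C * σ * M₁.rank * φ / s := by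
    intro φ s hφ hs
    calc _ = 72 * K * σ * M₁.rank * φ / s := by ring
      _ ≤ _ := by gcongr
  have h5 := key _ _ p₀ q₀
  have h6 := key _ _ p₁ q₁
  rw [mul_add] at h2
  linarith

end CriticalValue

/-! ### Constancy along the fibres of the latent variables -/

namespace Panel

variable {Ω : Type*} [MeasurableSpace Ω] [StandardBorelSpace Ω] {N T₀ T₁ D r : ℕ}
  {S : Panel Ω N T₀ T₁ D r} {P : Measure Ω} [IsFiniteMeasure P]

omit [StandardBorelSpace Ω] in
theorem assign_congr {ω ω' : Ω} (h : S.latent ω' = S.latent ω) :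
    (fun n => S.assign n ω') = fun n => S.assign n ω :=
  congrArg (fun x => x.2.2) h

omit [StandardBorelSpace Ω] in
theorem outcome_sub_shock_congr [NeZero D] (hS : S.SUTVA) (hF : S.FactorModel) {ω ω' : Ω}
    (h : S.latent ω' = S.latent ω) (t : Fin (T₀ + T₁)) (n : Fin N) :
    S.outcome t n ω' - S.shock t n ω' = S.outcome t n ω - S.shock t n ω := by
  have hu : ∀ t d, S.u t d ω' = S.u t d ω := fun t d => congrFun (congrFun (congrArg (·.1) h) t) d
  have hv : S.v n ω' = S.v n ω := congrFun (congrArg (·.2.1) h) n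
  have ha : S.assign n ω' = S.assign n ω := congrFun (congrArg (·.2.2) h) n
  induction t using Fin.addCases with
  | left t => rw [(hS n ω').1, (hS n ω).1, hF, hF, hu, hv]; ring
  | right t => rw [(hS n ω').2, (hS n ω).2, hF, hF, hu, hv, ha]; ring

/-- Outcome minus shock depends on the latent variables alone, so it is constant on the fibre; as
the shock is centred, this constant is the conditional mean. -/
theorem outcome_sub_integral [NeZero D] (hS : S.SUTVA) (hF : S.FactorModel) {ω ω' : Ω}
    (hfib : ∀ᵐ x ∂(S.condLaw P ω), S.latent x = S.latent ω)
    (hω : ∀ t n, Integrable (S.shock t n) (S.condLaw P ω) ∧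
      ∫ x, S.shock t n x ∂(S.condLaw P ω) = 0)
    (h : S.latent ω' = S.latent ω) (t : Fin (T₀ + T₁)) (n : Fin N) :
    S.outcome t n ω' - ∫ x, S.outcome t n x ∂(S.condLaw P ω') = S.shock t n ω' := by
  rw [S.condLaw_congr P h]
  have h1 : S.outcome t n =ᵐ[S.condLaw P ω]
      fun x => (S.outcome t n ω' - S.shock t n ω') + S.shock t n x := by
    filter_upwards [hfib] with x hx
    rw [outcome_sub_shock_congr hS hF (h.trans hx.symm)]
    ring
  rw [integral_congr_ae h1, integral_add (integrable_const _) (hω t n).1, (hω t n).2]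
  simp

theorem aligned_congr {d : Fin D} {ω ω' : Ω} (h : S.latent ω' = S.latent ω)
    (hA : Aligned (S.meanPre P d ω) (S.meanPost P d ω)) :
    Aligned (S.meanPre P d ω') (S.meanPost P d ω') := by
  -- The matrix types depend on the assignment. Abstracting assignment and law as variables lets
  -- both be rewritten at once.
  let Q : (Fin N → Fin D) → Measure Ω → Prop := fun a ν =>
    Aligned (Matrix.of fun (t : Fin T₀) (j : {n // a n = d}) =>
        ∫ x, S.outcome (Fin.castAdd T₁ t) j x ∂ν)
      (Matrix.of fun (t : Fin T₁) (j : {n // a n = d}) =>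
        ∫ x, S.outcome (Fin.natAdd T₀ t) j x ∂ν)
  have hQ : Q (fun n => S.assign n ω) (S.condLaw P ω) := hA
  rw [← assign_congr h, ← S.condLaw_congr P h] at hQ
  exact hQ

theorem separated_congr {d : Fin D} {C σ α : ℝ} {ω ω' : Ω} (h : S.latent ω' = S.latent ω)
    (hA : Separated (S.meanPre P d ω) (S.meanPost P d ω) C σ α) :
    Separated (S.meanPre P d ω') (S.meanPost P d ω') C σ α := by
  let Q : (Fin N → Fin D) → Measure Ω → Prop := fun a ν =>
    Separated (Matrix.of fun (t : Fin T₀) (j : {n // a n = d}) =>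
        ∫ x, S.outcome (Fin.castAdd T₁ t) j x ∂ν)
      (Matrix.of fun (t : Fin T₁) (j : {n // a n = d}) =>
        ∫ x, S.outcome (Fin.natAdd T₀ t) j x ∂ν) C σ α
  have hQ : Q (fun n => S.assign n ω) (S.condLaw P ω) := hA
  rw [← assign_congr h, ← S.condLaw_congr P h] at hQ
  exact hQ

/-- The noise in the rows `ι` of the units that receive `d` at `ω`. -/
def noise (S : Panel Ω N T₀ T₁ D r) (d : Fin D) {T : ℕ} (ι : Fin T → Fin (T₀ + T₁)) (ω ω' : Ω) :
    Matrix (Fin T) (S.Donors d ω) ℝ :=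
  Matrix.of fun t j => S.shock (ι t) j ω'

omit [StandardBorelSpace Ω] in
theorem opNormLE_noise_congr {d : Fin D} {T : ℕ} {ι : Fin T → Fin (T₀ + T₁)} {c a : ℝ}
    {ω ω' : Ω} (h : S.latent ω' = S.latent ω)
    (hA : OpNormLE (S.noise d ι ω ω') (c * phi T (S.numDonors d ω) a)) :
    OpNormLE (S.noise d ι ω' ω') (c * phi T (S.numDonors d ω') a) := by
  let Q : (Fin N → Fin D) → Prop := fun b =>
    OpNormLE (Matrix.of fun (t : Fin T) (j : {n // b n = d}) => S.shock (ι t) j ω')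
      (c * phi T (Fintype.card {n // b n = d}) a)
  have hQ : Q (fun n => S.assign n ω) := hA
  rw [← assign_congr h] at hQ
  exact hQ

theorem condLaw_not_opNormLE_noise_le {K σ : ℝ} (hK : 0 < K) (hσ : 0 ≤ σ) {ω : Ω}
    (hmean : ∀ t n, Integrable (S.shock t n) (S.condLaw P ω) ∧
      ∫ x, S.shock t n x ∂(S.condLaw P ω) = 0)
    (hind : iIndepFun (fun p : Fin (T₀ + T₁) × Fin N => S.shock p.1 p.2) (S.condLaw P ω))
    (hpsi : ∀ t n, psiTwoNorm (S.shock t n) (S.condLaw P ω) ≤ ENNReal.ofReal (K * σ))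
    (d : Fin D) {T : ℕ} {ι : Fin T → Fin (T₀ + T₁)} (hι : Function.Injective ι) {a : ℝ}
    (ha : 0 < a) (ha1 : a ≤ 1) :
    S.condLaw P ω {ω' | ¬ OpNormLE (S.noise d ι ω ω')
      (12 * (K * σ) * phi T (S.numDonors d ω) a)} ≤ ENNReal.ofReal a := by
  have hs : 0 ≤ K * σ := by positivity
  have hinj : Function.Injective fun p : Fin T × S.Donors d ω => (ι p.1, (p.2 : Fin N)) := by
    rintro ⟨t, j⟩ ⟨t', j'⟩ h
    rw [Prod.mk.injEq] at h ⊢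
    exact ⟨hι h.1, Subtype.ext h.2⟩
  have := measure_not_opNormLE_le (ε := fun t (j : S.Donors d ω) => S.shock (ι t) j) hs
    (hind.precomp hinj) (fun t j => hasSubgaussianMGF_of_psiTwoNorm_le (S.measurable_shock _ _)
      (hmean _ _).1 (hmean _ _).2 hs (hpsi _ _)) ha ha1
  rw [Fintype.card_fin] at this
  exact this

end Panel

/-! ### Conditional error probabilities -/

/-- No measurability is asked of `s`: the singular vectors are chosen arbitrarily at each ω, so the
error events need not be measurable. -/
theorem measure_le_of_subset_union {Ω : Type*} [MeasurableSpace Ω] {μ : Measure Ω} {p : Ω → Prop}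
    {A B s : Set Ω} {a : ℝ} (ha : 0 ≤ a) (hp : ∀ᵐ x ∂μ, p x) (hA : μ A ≤ ENNReal.ofReal (a / 2))
    (hB : μ B ≤ ENNReal.ofReal (a / 2)) (h : ∀ x ∈ s, p x → x ∈ A ∪ B) :
    μ s ≤ ENNReal.ofReal a := by
  have h1 : s ≤ᵐ[μ] (A ∪ B : Set Ω) := by
    filter_upwards [hp] with x hx hxs using h x hxs hx
  calc μ s ≤ μ (A ∪ B) := measure_mono_ae h1
    _ ≤ μ A + μ B := measure_union_le _ _
    _ ≤ ENNReal.ofReal (a / 2) + ENNReal.ofReal (a / 2) := add_le_add hA hB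
    _ = ENNReal.ofReal a := by
        rw [← ENNReal.ofReal_add (by positivity) (by positivity), add_halves]

theorem theorem4 (K : ℝ) (hK : 0 < K) :
    ∃ C₀ : ℝ, 0 ≤ C₀ ∧ ∀ C : ℝ, C₀ ≤ C →
      ∀ (N T₀ T₁ D r : ℕ) [NeZero D], 1 ≤ T₀ → 1 ≤ T₁ →
      ∀ (Ω : Type*) [MeasurableSpace Ω] [StandardBorelSpace Ω]
        (P : Measure Ω) [IsProbabilityMeasure P]
        (S : Panel Ω N T₀ T₁ D r) (σ : ℝ), 0 ≤ σ →
        S.SUTVA → S.FactorModel → S.CondMeanZero P → S.SubGaussianShocks P σ K →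
      ∀ (d : Fin D)
        (Vpre Vpre_hat : (ω : Ω) → Matrix (S.Donors d ω) (Fin (S.rPre P d ω)) ℝ)
        (Vpost Vpost_hat : (ω : Ω) → Matrix (S.Donors d ω) (Fin (S.rPost P d ω)) ℝ),
        (∀ ω, IsTopRightSingularVectors (S.meanPre P d ω) (Vpre ω)) →
        (∀ ω, IsTopRightSingularVectors (S.meanPost P d ω) (Vpost ω)) →
        (∀ ω, IsTopRightSingularVectors (S.Ypre d ω) (Vpre_hat ω)) →
        (∀ ω, IsTopRightSingularVectors (S.Ypost d ω) (Vpost_hat ω)) →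
      ∀ α : ℝ, 0 < α → α < 1 →
        (∀ᵐ ω ∂P, colSpan (Vpost ω) ≤ colSpan (Vpre ω) →
          S.condLaw P ω {ω' | S.criticalValue P d ω' C σ α
              < subspaceStat (Vpre_hat ω') (Vpost_hat ω')} ≤ ENNReal.ofReal α) ∧
        (∀ᵐ ω ∂P,
          frobSq (Vpre ω * (Vpre ω)ᵀ * Vpost ω) + 2 * S.criticalValue P d ω C σ α
              + C * σ * S.rPost P d ω * phi T₁ (S.numDonors d ω) (α / 2) / S.sPost P d ω
            < S.rPost P d ω →
          ¬ colSpan (Vpost ω) ≤ colSpan (Vpre ω) ∧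
          S.condLaw P ω {ω' | subspaceStat (Vpre_hat ω') (Vpost_hat ω')
              ≤ S.criticalValue P d ω' C σ α} ≤ ENNReal.ofReal α) := by
  refine ⟨1152 * K ^ 2 + 72 * K, by positivity, fun C hC => ?_⟩
  intro N T₀ T₁ D r _ _ _ Ω _ _ P _ S σ hσ hS hF hM hG d Vpre Vpre_hat Vpost Vpost_hat hVpre
    hVpost hVpre_hat hVpost_hat α hα hα1
  have hK2 : 0 ≤ 1152 * K ^ 2 := by positivity
  have hC1 : 1152 * K ^ 2 ≤ C := by linarith
  have hC2 : 72 * K ≤ C := by linarith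
  have hC0 : 0 ≤ C := hK2.trans hC1
  have hdet : ∀ᵐ ω ∂P, ∃ A B : Set Ω, S.condLaw P ω A ≤ ENNReal.ofReal (α / 2) ∧
      S.condLaw P ω B ≤ ENNReal.ofReal (α / 2) ∧ (∀ᵐ ω' ∂(S.condLaw P ω),
        S.latent ω' = S.latent ω) ∧ ∀ ω', S.latent ω' = S.latent ω → ω' ∉ A ∪ B →
          OpNormLE (S.Ypre d ω' - S.meanPre P d ω')
            (12 * (K * σ) * phi T₀ (S.numDonors d ω') (α / 2)) ∧
          OpNormLE (S.Ypost d ω' - S.meanPost P d ω')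
            (12 * (K * σ) * phi T₁ (S.numDonors d ω') (α / 2)) := by
    filter_upwards [hM, hG, S.ae_condLaw_latent_eq P] with ω hmean hsub hfib
    have hbound := fun {T : ℕ} {ι : Fin T → Fin (T₀ + T₁)} (hι : Function.Injective ι) =>
      Panel.condLaw_not_opNormLE_noise_le hK hσ hmean hsub.1 (fun t n => (hsub.2 t n).2) d hι
        (half_pos hα) (by linarith)
    refine ⟨_, _, hbound (Fin.castAdd_injective T₀ T₁), hbound (Fin.natAdd_injective T₁ T₀), hfib,
      fun ω' hω' hnot => ?_⟩
    rw [Set.mem_union, not_or, Set.notMem_ofPred_iff, Set.notMem_ofPred_iff, not_not, not_not] at hnot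
    have h₀ := Panel.opNormLE_noise_congr hω' hnot.1
    have h₁ := Panel.opNormLE_noise_congr hω' hnot.2
    have e₀ : S.Ypre d ω' - S.meanPre P d ω' = S.noise d (Fin.castAdd T₁) ω' ω' := by
      ext t j
      exact Panel.outcome_sub_integral hS hF hfib hmean hω' _ _
    have e₁ : S.Ypost d ω' - S.meanPost P d ω' = S.noise d (Fin.natAdd T₀) ω' ω' := by
      ext t j
      exact Panel.outcome_sub_integral hS hF hfib hmean hω' _ _
    rw [e₀, e₁]
    exact ⟨h₀, h₁⟩
  constructor
  · filter_upwards [hdet] with ω hω hH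
    obtain ⟨A, B, hA, hB, hfib, hAB⟩ := hω
    -- The existential form forgets the particular `Vpre ω` and `Vpost ω`, whose choice may vary
    -- along the fibre, and so can be transported to `ω'`.
    have hal : Aligned (S.meanPre P d ω) (S.meanPost P d ω) :=
      ⟨Vpre ω, Vpost ω, hVpre ω, hVpost ω, hH⟩
    refine measure_le_of_subset_union hα.le hfib hA hB fun ω' hbad hω' => ?_
    by_contra hnot
    obtain ⟨h₀, h₁⟩ := hAB ω' hω' hnot
    exact absurd ((Panel.aligned_congr hω' hal).subspaceStat_le hK hσ hC1 (hVpre_hat ω')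
      (hVpost_hat ω') h₀ h₁) (not_le.2 hbad)
  · filter_upwards [hdet] with ω hω hH
    obtain ⟨A, B, hA, hB, hfib, hAB⟩ := hω
    refine ⟨fun hle => ?_, ?_⟩
    -- Under inclusion of spans the Frobenius term already equals the rank, and the other terms are
    -- nonnegative.
    · have h1 := frobSq_add_subspaceStat (hVpre ω).orthonormal (hVpost ω).orthonormal
      rw [subspaceStat_eq_zero_of_colSpan_le (hVpre ω).orthonormal hle, add_zero] at h1
      rw [h1] at hH
      have h2 : 0 ≤ S.criticalValue P d ω C σ α := matrixCriticalValue_nonneg hC0 hσ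
      have h3 : 0 ≤ C * σ * S.rPost P d ω * phi T₁ (S.numDonors d ω) (α / 2) / S.sPost P d ω := by
        have := phi_nonneg T₁ (S.numDonors d ω) (α / 2)
        have : 0 ≤ S.sPost P d ω := singularValue_nonneg _ _
        positivity
      linarith
    · have hsep : Separated (S.meanPre P d ω) (S.meanPost P d ω) C σ α :=
        ⟨Vpre ω, Vpost ω, hVpre ω, hVpost ω, hH⟩
      refine measure_le_of_subset_union hα.le hfib hA hB fun ω' hbad hω' => ?_
      by_contra hnot
      obtain ⟨h₀, h₁⟩ := hAB ω' hω' hnot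
      exact absurd ((Panel.separated_congr hω' hsep).matrixCriticalValue_lt hK hσ hC2 (hVpre_hat ω')
        (hVpost_hat ω') h₀ h₁) (not_lt.2 hbad)
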